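/- **Strong consistency of GP-C-OCBA.** Let $\mathcal K$ be a finite set of at least two alternatives, $\mathcal C$ a finite set of contexts and $F:\mathcal K\times\mathcal C\to\mathbb R$ an unknown (fixed) reward function such that for every $c$ the best alternative $\pi^*(c)=\arg\max_{k}F(k,c)$ is unique. The $j$-th observation of a pair $(k,c)$ equals $F(k,c)+\epsilon^j(k,c)$, where the $\epsilon^j(k,c)\sim\mathcal N(0,\sigma^2(k,c))$ are independent across $j,k,c$ and the variances $\sigma^2(k,c)>0$ are known. For each $k$ fix a Gaussian process prior on $F(k,\cdot)$ with mean $\mu_0(k,\cdot)$ and strictly positive definite covariance matrix $\Sigma_0(\cdot,\cdot;k)$ on $\mathcal C$; it does not change during the sampling. After $n$ observations in total, let $D_n(k)$ and $Y_n(k)$ be the vectors of the contexts at which $k$ was sampled and of the values observed there, and put $A_n(k)=\Sigma_0(D_n(k),D_n(k);k)+\mathrm{diag}(\sigma^2(k,D_n(k)))$, $$\mu_n(k,c)=\mu_0(k,c)+\Sigma_0(c,D_n(k);k)\,A_n(k)^{-1}\bigl(Y_n(k)-\mu_0(k,D_n(k))\bigr),$$ $$\Sigma_n(k,c)=\Sigma_0(c,c;k)-\Sigma_0(c,D_n(k);k)\,A_n(k)^{-1}\,\Sigma_0(D_n(k),c;k).$$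 Let $\pi^n(c)\in\arg\max_k\mu_n(k,c)$ be the predicted best alternative, $N_n(k,c)$ the number of observations of $(k,c)$ among the first $n$, and $\hat p_n(k,c)=N_n(k,c)/n$ (with $\hat p_0=0$). The GP-C-OCBA policy first takes some number $N_0$ of initial observations and then, for each $n\ge N_0$, computes $$\zeta(k,c)=\frac{(\mu_n(\pi^n(c),c)-\mu_n(k,c))^2}{\Sigma_n(\pi^n(c),c)+\Sigma_n(k,c)}\quad(k\ne\pi^n(c)),$$ $$\psi^{(1)}(c)=\frac{\hat p_n(\pi^n(c),c)}{\Sigma_n(\pi^n(c),c)},\qquad \psi^{(2)}(c)=\sum_{k\neq\pi^n(c)}\frac{\hat p_n(k,c)}{\Sigma_n(k,c)},$$ takes a minimizer $(\tilde k,\tilde c)$ of $\zeta(k,c)$ over all $c\in\mathcal C$ and $k\ne\pi^n(c)$, and draws the next observation from $(\pi^n(\tilde c),\tilde c)$ if $\psi^{(1)}(\tilde c)<\psi^{(2)}(\tilde c)$, and from $(\tilde k,\tilde c)$ otherwise. Ties are broken arbitrarily; every choice of a pair to sample, in the initial phase too, depends only on the pairs and values observed so far and possibly on an exogenous randomization that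 is independent of the noise. Then almost surely $\pi^B(c)\to\pi^*(c)$ for every $c\in\mathcal C$ as the observation budget $B\to\infty$; that is, almost surely, for every $c$, $\pi^B(c)=\pi^*(c)$ for all sufficiently large $B$. -/

import Mathlib

open MeasureTheory ProbabilityTheory Filter
open scoped Matrix NNReal

namespace ContextualRS

/-- Parameters of the statistical model: for every alternative `k`, a Gaussian process prior over
the finite context set with mean `mean k` and covariance matrix `cov k`, together with the known
variance `noiseVar k c` of the observation noise at the pair `(k, c)`. -/
structure GPModel (K C : Type*) where
  /-- prior mean `μ₀(k, c)` -/
  mean : K → C → ℝ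
  /-- prior covariance `Σ₀(c, c'; k)` -/
  cov : K → Matrix C C ℝ
  /-- noise variance `σ²(k, c)` -/
  noiseVar : K → C → ℝ≥0

section Path

/- In this section `x i` is the pair sampled at step `i` (steps are numbered from `0`) and `y i` is
the value observed there, so "at time `n`" means "after the observations `0, …, n - 1`". -/

variable {K C : Type*} [DecidableEq K] [DecidableEq C]

/-- `N_n(k, c)`: how often the pair `a = (k, c)` has been sampled up to time `n`. -/
def sampleCount (x : ℕ → K × C) (n : ℕ) (a : K × C) : ℕ :=
  ((Finset.range n).filter fun i => x i = a).card

/-- The steps before time `n` at which the alternative `k` was sampled. -/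
abbrev ObsIdx (x : ℕ → K × C) (n : ℕ) (k : K) : Type :=
  {i : Fin n // (x i).1 = k}

/-- The contexts `D_n(k)` at which `k` has been evaluated up to time `n` (with repetitions). -/
def obsContext (x : ℕ → K × C) (n : ℕ) (k : K) (i : ObsIdx x n k) : C := (x i.1).2

namespace GPModel

variable (M : GPModel K C)

/-- `A_n(k) = Σ₀(D_n(k), D_n(k); k) + diag(σ²(k, D_n(k)))`. -/
def obsCov (x : ℕ → K × C) (n : ℕ) (k : K) : Matrix (ObsIdx x n k) (ObsIdx x n k) ℝ :=
  (M.cov k).submatrix (obsContext x n k) (obsContext x n k) +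
    Matrix.diagonal fun i => (M.noiseVar k (obsContext x n k i) : ℝ)

/-- The posterior mean
`μ_n(k, c) = μ₀(k, c) + Σ₀(c, D_n(k); k) A_n(k)⁻¹ (Y_n(k) - μ₀(k, D_n(k)))`. -/
noncomputable def postMean (x : ℕ → K × C) (y : ℕ → ℝ) (n : ℕ) (k : K) (c : C) : ℝ :=
  M.mean k c + (fun i => M.cov k c (obsContext x n k i)) ⬝ᵥ
    ((M.obsCov x n k)⁻¹ *ᵥ fun i => y i.1 - M.mean k (obsContext x n k i))

/-- The posterior covariance
`Σ_n(c, c'; k) = Σ₀(c, c'; k) - Σ₀(c, D_n(k); k) A_n(k)⁻¹ Σ₀(D_n(k), c'; k)`. -/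
noncomputable def postCov (x : ℕ → K × C) (n : ℕ) (k : K) (c c' : C) : ℝ :=
  M.cov k c c' - (fun i => M.cov k c (obsContext x n k i)) ⬝ᵥ
    ((M.obsCov x n k)⁻¹ *ᵥ fun i => M.cov k (obsContext x n k i) c')

/-- The posterior variance `Σ_n(k, c) = Σ_n(c, c; k)`. -/
noncomputable def postVar (x : ℕ → K × C) (n : ℕ) (k : K) (c : C) : ℝ :=
  M.postCov x n k c c

/-- `b` is a predicted best policy `π^n` at time `n`: `b c ∈ argmax_k μ_n(k, c)` for every `c`. -/
def IsPredictedBest (x : ℕ → K × C) (y : ℕ → ℝ) (n : ℕ) (b : C → K) : Prop :=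
  ∀ c k, M.postMean x y n k c ≤ M.postMean x y n (b c) c

/-- `ζ(k, c) = (μ_n(π^n(c), c) - μ_n(k, c))² / (Σ_n(π^n(c), c) + Σ_n(k, c))`, where `b = π^n`. -/
noncomputable def zeta (x : ℕ → K × C) (y : ℕ → ℝ) (n : ℕ) (b : C → K) (k : K) (c : C) : ℝ :=
  (M.postMean x y n (b c) c - M.postMean x y n k c) ^ 2 /
    (M.postVar x n (b c) c + M.postVar x n k c)

end GPModel

/-- `p̂(k, c)`: the fraction of the first `n` samples that were allocated to `(k, c)`. -/
noncomputable def sampleFrac (x : ℕ → K × C) (n : ℕ) (k : K) (c : C) : ℝ :=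
  (sampleCount x n (k, c) : ℝ) / (n : ℝ)

namespace GPModel

variable (M : GPModel K C)

/-- `ψ⁽¹⁾(c) = p̂(π^n(c), c) / Σ_n(π^n(c), c)`, where `b = π^n`. -/
noncomputable def psi₁ (x : ℕ → K × C) (n : ℕ) (b : C → K) (c : C) : ℝ :=
  sampleFrac x n (b c) c / M.postVar x n (b c) c

/-- `ψ⁽²⁾(c) = ∑_{k ≠ π^n(c)} p̂(k, c) / Σ_n(k, c)`, where `b = π^n`. -/
noncomputable def psi₂ [Fintype K] (x : ℕ → K × C) (n : ℕ) (b : C → K) (c : C) : ℝ :=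
  ∑ k ∈ Finset.univ.filter (fun k => k ≠ b c), sampleFrac x n k c / M.postVar x n k c

/-- One iteration of GP-C-OCBA at time `n` may choose `next` as the pair to be sampled: for some
minimizer `(k, c)` of `ζ` over all pairs with `k ≠ π^n(c)`, it is `(π^n(c), c)` if
`ψ⁽¹⁾(c) < ψ⁽²⁾(c)`, and `(k, c)` otherwise. -/
def IsOCBAStep [Fintype K] (x : ℕ → K × C) (y : ℕ → ℝ) (n : ℕ) (b : C → K)
    (next : K × C) : Prop :=
  ∃ k c, k ≠ b c ∧ (∀ k' c', k' ≠ b c' → M.zeta x y n b k c ≤ M.zeta x y n b k' c') ∧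
    next = if M.psi₁ x n b c < M.psi₂ x n b c then (b c, c) else (k, c)

end GPModel

end Path

section Policy

variable {K C Ω : Type*} [DecidableEq K] [DecidableEq C]

/-- The value observed at step `n`: if `X n = (k, c)` and this pair has been sampled `j` times
before, it is `F(k, c) + ε_j(k, c)`, with a fresh noise variable for every observation. -/
def observation (F : K → C → ℝ) (ε : ℕ → K → C → Ω → ℝ) (X : ℕ → Ω → K × C) (n : ℕ) (ω : Ω) : ℝ :=
  F (X n ω).1 (X n ω).2 +
    ε (sampleCount (fun i => X i ω) n (X n ω)) (X n ω).1 (X n ω).2 ω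

/-- The information available before step `n`: the first `n` sampled pairs and observed values, and
the σ-algebra `𝒰` of an exogenous randomization. -/
abbrev history (𝒰 : MeasurableSpace Ω) (X : ℕ → Ω → K × C) (Y : ℕ → Ω → ℝ) (n : ℕ) :
    MeasurableSpace Ω :=
  𝒰 ⊔ ⨆ i : Fin n, (MeasurableSpace.comap (X i) ⊤ ⊔ MeasurableSpace.comap (Y i) inferInstance)

/-- `X` (the sampled pairs) and `best` (the predicted best alternatives `π^n(c)`) are produced by
the GP-C-OCBA policy after `N₀` initial samples. Ties are broken arbitrarily; the choice of the next
pair, in the initial phase too, uses nothing but the information available at that time. -/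
structure IsGPCOCBA [Fintype K] (M : GPModel K C) (F : K → C → ℝ) (ε : ℕ → K → C → Ω → ℝ)
    (𝒰 : MeasurableSpace Ω) (N₀ : ℕ) (X : ℕ → Ω → K × C) (best : ℕ → Ω → C → K) : Prop where
  nonanticipating : ∀ n, Measurable[history 𝒰 X (observation F ε X) n, ⊤] (X n)
  predictedBest : ∀ n ω,
    M.IsPredictedBest (fun i => X i ω) (fun i => observation F ε X i ω) n (best n ω)
  step : ∀ n ω, N₀ ≤ n →
    M.IsOCBAStep (fun i => X i ω) (fun i => observation F ε X i ω) n (best n ω) (X n ω)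

end Policy

end ContextualRS

namespace ContextualRS

/-! The argument is pathwise. Each visit to a pair consumes the next entry of that pair's noise
sequence, so under any allocation the data enter only through the walks `noiseSum` evaluated at the
visit counts. If every pair is sampled infinitely often, the posterior means converge to `F`
(`tendsto_postMean`) and uniqueness of the best alternative finishes (`eventually_best_eq`). The
heart is `IsRegularPath.sampledInfOften`.

Suppose some pair is sampled finitely often. Its posterior variance stays away from `0`, so the
minimum of ζ stays below some `Z` (`zeta_bounded`), whereas ζ tends to infinity between two
infinitely sampled pairs with different rewards. Hence all infinitely sampled pairs at one context
have equal rewards (`reward_eq`), and the balance rule gives each of them a rival with a comparable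
visit count (`exists_comparable`). Without ties this is already absurd, but suboptimal alternatives
may be tied, and then the law of large numbers does not decide the matter.

Ties are broken by fluctuations. Almost surely, for every pair and every `Q` there are infinitely
many `L` at which its walk is below `-Q √L`, while the walks of all other pairs stay above `-(√L + N
/ √L)` at all times `N`. Once the pair has been sampled `L` times, its posterior mean trails by a
large multiple of `1 / √L`, while the variances in ζ would be `O(1 / L)` if it were chosen. So ζ
would exceed `Z`, and the pair is never sampled again, a contradiction. Such excursions exist by the
second Borel–Cantelli lemma on independent, rapidly growing blocks of noise (`ae_regular_noise`). -/

/-- Partial sums of the noise at the pair `a`. -/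
def noiseSum {K C : Type*} (e : ℕ → K → C → ℝ) (a : K × C) (N : ℕ) : ℝ :=
  ∑ j ∈ Finset.range N, e j a.1 a.2

/-! ### Visit counts and regrouping of sums over observations. -/

section Counting

variable {K C : Type*} [DecidableEq K] [DecidableEq C]

lemma sampleCount_succ (x : ℕ → K × C) (n : ℕ) (a : K × C) :
    sampleCount x (n + 1) a = sampleCount x n a + if x n = a then 1 else 0 := by
  unfold sampleCount
  rw [Finset.range_add_one, Finset.filter_insert]
  split_ifs with h
  · rw [Finset.card_insert_of_notMem (by simp)]
  · rfl

lemma sampleCount_mono (x : ℕ → K × C) (a : K × C) : Monotone fun n => sampleCount x n a :=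
  monotone_nat_of_le_succ fun n => by rw [sampleCount_succ]; exact Nat.le_add_right _ _

/-- The `j`-th visit to `a` uses the `j`-th noise variable, so the accumulated noise is a fixed walk
stopped at the visit count. This separates the noise from the allocation. -/
lemma sum_noise_eq_noiseSum (e : ℕ → K → C → ℝ) (x : ℕ → K × C) (n : ℕ) (a : K × C) :
    (∑ i ∈ Finset.range n, if x i = a then e (sampleCount x i (x i)) (x i).1 (x i).2 else 0) =
      noiseSum e a (sampleCount x n a) := by
  induction n with
  | zero => simp [noiseSum, sampleCount]
  | succ n ih =>
    rw [Finset.sum_range_succ, ih, sampleCount_succ]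
    split_ifs with h
    · rw [noiseSum, noiseSum, Finset.sum_range_succ, h]
    · simp

/-- A sum over the observations of `k` made in the context `c`, as a sum over all steps. -/
lemma sum_obsIdx (x : ℕ → K × C) (n : ℕ) (k : K) (c : C) (g : ℕ → ℝ) :
    (∑ i : ObsIdx x n k, if obsContext x n k i = c then g i.1 else 0) =
      ∑ i ∈ Finset.range n, if x i = (k, c) then g i else 0 := by
  rw [← Fin.sum_univ_eq_sum_range (fun i => if x i = (k, c) then g i else 0) n]
  have h := Finset.sum_subtype (F := inferInstanceAs (Fintype (ObsIdx x n k)))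
    (Finset.univ.filter fun i : Fin n => (x i).1 = k)
    (p := fun i : Fin n => (x i).1 = k) (by simp)
    (fun i : Fin n => if (x i).2 = c then g i else 0)
  unfold obsContext
  rw [← h, Finset.sum_filter]
  refine Finset.sum_congr rfl fun i _ => ?_
  by_cases h1 : (x i).1 = k <;> by_cases h2 : (x i).2 = c <;> simp [h1, h2, Prod.ext_iff]

lemma sum_obsIdx_one (x : ℕ → K × C) (n : ℕ) (k : K) (c : C) :
    (∑ i : ObsIdx x n k, if obsContext x n k i = c then (1 : ℝ) else 0) =
      sampleCount x n (k, c) := by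
  rw [sum_obsIdx x n k c fun _ => 1]
  simp [sampleCount]

lemma sampleCount_tendsto_or_bounded (x : ℕ → K × C) (a : K × C) :
    Tendsto (fun n => sampleCount x n a) atTop atTop ∨ ∃ b, ∀ n, sampleCount x n a ≤ b := by
  by_cases h : ∃ b, ∀ n, sampleCount x n a ≤ b
  · exact Or.inr h
  · push Not at h
    refine Or.inl (tendsto_atTop_mono' _ EventuallyLE.rfl ?_)
    exact tendsto_atTop_atTop_of_monotone (sampleCount_mono x a) fun b =>
      (h b).imp fun n hn => hn.le

end Counting

/-! ### Posterior mean and covariance as solutions of equations in context space. -/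

namespace GPModel

lemma posDef_obsCov {K C : Type*} [DecidableEq K] (M : GPModel K C)
    (hcov : ∀ k, (M.cov k).PosDef) (hvar : ∀ k c, 0 < M.noiseVar k c)
    (x : ℕ → K × C) (n : ℕ) (k : K) : (M.obsCov x n k).PosDef := by
  unfold obsCov
  exact Matrix.PosDef.posSemidef_add ((hcov k).posSemidef.submatrix _)
    (Matrix.PosDef.diagonal fun i => by exact_mod_cast hvar _ _)

variable {K C : Type*} [DecidableEq K] [DecidableEq C] [Fintype C] (M : GPModel K C)

/-- A vector over observations matters only through its sums over each context, so systems of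
growing size reduce to systems indexed by `C`. -/
lemma dotProduct_obsContext (x : ℕ → K × C) (n : ℕ) (k : K) (c : C) (z : ObsIdx x n k → ℝ) :
    (fun i => M.cov k c (obsContext x n k i)) ⬝ᵥ z =
      (M.cov k *ᵥ fun c' => ∑ i, if obsContext x n k i = c' then z i else 0) c := by
  simp only [dotProduct, Matrix.mulVec, Finset.mul_sum]
  rw [Finset.sum_comm]
  refine Finset.sum_congr rfl fun i _ => ?_
  simp

/-- The normal equations in context space for a linear system in observation space. -/
lemma gain_eq (hcov : ∀ k, (M.cov k).PosDef) (hvar : ∀ k c, 0 < M.noiseVar k c)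
    (x : ℕ → K × C) (n : ℕ) (k : K) (u : ObsIdx x n k → ℝ) (q : C → ℝ)
    (hq : ∀ c, q c = (fun i => M.cov k c (obsContext x n k i)) ⬝ᵥ ((M.obsCov x n k)⁻¹ *ᵥ u)) :
    q = M.cov k *ᵥ fun c => ((∑ i, if obsContext x n k i = c then u i else 0) -
      sampleCount x n (k, c) * q c) / M.noiseVar k c := by
  set z := (M.obsCov x n k)⁻¹ *ᵥ u with hz
  have hu : M.obsCov x n k *ᵥ z = u := by
    rw [hz, Matrix.mulVec_mulVec, Matrix.mul_nonsing_inv, Matrix.one_mulVec]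
    exact (Matrix.isUnit_iff_isUnit_det _).1 (M.posDef_obsCov hcov hvar x n k).isUnit
  -- Row `i` of `A_n z = u`. Summing it over the observations at one context expresses the context
  -- sums of `z` through those of `u` and the count.
  have hzi : ∀ i, u i = q (obsContext x n k i) + M.noiseVar k (obsContext x n k i) * z i := by
    intro i
    rw [← hu, obsCov, Matrix.add_mulVec, Pi.add_apply, Matrix.mulVec_diagonal, hq]
    rfl
  have hq' : q = M.cov k *ᵥ fun c' => ∑ i, if obsContext x n k i = c' then z i else 0 := by
    funext c
    rw [hq, M.dotProduct_obsContext]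
  conv_lhs => rw [hq']
  congr 1
  funext c
  have hv : (M.noiseVar k c : ℝ) ≠ 0 := by exact_mod_cast (hvar k c).ne'
  rw [eq_div_iff hv, ← sum_obsIdx_one, Finset.sum_mul, Finset.sum_mul, ← Finset.sum_sub_distrib]
  refine Finset.sum_congr rfl fun i _ => ?_
  split_ifs with h
  · rw [hzi i, h]; ring
  · simp

variable {M}

lemma precision_mulVec {K C : Type*} [DecidableEq C] [Fintype C] {M : GPModel K C} {k : K}
    (hcov : (M.cov k).PosDef) {q r : C → ℝ}
    (h : q = M.cov k *ᵥ r) : (M.cov k)⁻¹ *ᵥ q = r := by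
  rw [h, Matrix.mulVec_mulVec, Matrix.nonsing_inv_mul, Matrix.one_mulVec]
  exact (Matrix.isUnit_iff_isUnit_det _).1 hcov.isUnit

/-- A column of the posterior covariance solves the system given by the posterior precision. -/
lemma precision_postCov (hcov : ∀ k, (M.cov k).PosDef) (hvar : ∀ k c, 0 < M.noiseVar k c)
    (x : ℕ → K × C) (n : ℕ) (k : K) (c c' : C) :
    ((M.cov k)⁻¹ *ᵥ fun d => M.postCov x n k d c) c' +
      sampleCount x n (k, c') / M.noiseVar k c' * M.postCov x n k c' c =
      (Pi.single c 1 : C → ℝ) c' := by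
  have h := M.gain_eq hcov hvar x n k (fun i => M.cov k (obsContext x n k i) c)
    (fun d => M.cov k d c - M.postCov x n k d c) (fun d => by simp [postCov])
  have h2 : (fun d => M.postCov x n k d c) = M.cov k *ᵥ fun d => (Pi.single c 1 : C → ℝ) d -
      sampleCount x n (k, d) / M.noiseVar k d * M.postCov x n k d c := by
    have h3 : (fun d => M.postCov x n k d c) =
        M.cov k *ᵥ Pi.single c 1 - fun d => M.cov k d c - M.postCov x n k d c := by
      funext d
      simp
    rw [h3, h, ← Matrix.mulVec_sub]
    congr 1
    funext d
    simp only [Pi.sub_apply]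
    congr 1
    have : (∑ i, if obsContext x n k i = d then M.cov k (obsContext x n k i) c else 0) =
        sampleCount x n (k, d) * M.cov k d c := by
      rw [← sum_obsIdx_one, Finset.sum_mul]
      refine Finset.sum_congr rfl fun i _ => ?_
      split_ifs with hi
      · rw [hi]; ring
      · simp
    rw [this]
    ring
  rw [precision_mulVec (hcov k) h2]
  ring

/-- The posterior mean error solves the system given by the posterior precision. -/
lemma precision_postMean (hcov : ∀ k, (M.cov k).PosDef) (hvar : ∀ k c, 0 < M.noiseVar k c)
    (F : K → C → ℝ) (e : ℕ → K → C → ℝ) (x : ℕ → K × C) (y : ℕ → ℝ)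
    (hy : ∀ i, y i = F (x i).1 (x i).2 + e (sampleCount x i (x i)) (x i).1 (x i).2)
    (n : ℕ) (k : K) (c : C) :
    ((M.cov k)⁻¹ *ᵥ fun d => M.postMean x y n k d - F k d) c +
      sampleCount x n (k, c) / M.noiseVar k c * (M.postMean x y n k c - F k c) =
      noiseSum e (k, c) (sampleCount x n (k, c)) / M.noiseVar k c -
        ((M.cov k)⁻¹ *ᵥ fun d => F k d - M.mean k d) c := by
  have h := precision_mulVec (hcov k) <|
    M.gain_eq hcov hvar x n k (fun i => y i.1 - M.mean k (obsContext x n k i))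
      (fun d => M.postMean x y n k d - M.mean k d) (fun d => by simp [postMean])
  have h1 : (fun d => M.postMean x y n k d - F k d) =
      (fun d => M.postMean x y n k d - M.mean k d) - fun d => F k d - M.mean k d := by
    funext d; simp
  have h2 : (∑ i, if obsContext x n k i = c then y i.1 - M.mean k (obsContext x n k i) else 0) =
      noiseSum e (k, c) (sampleCount x n (k, c)) +
        sampleCount x n (k, c) * (F k c - M.mean k c) := by
    rw [← sum_noise_eq_noiseSum, ← sum_obsIdx_one, Finset.sum_mul,
      ← sum_obsIdx x n k c fun i => e (sampleCount x i (x i)) (x i).1 (x i).2,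
      ← Finset.sum_add_distrib]
    refine Finset.sum_congr rfl fun i _ => ?_
    split_ifs with hi
    · have hk : x i.1 = (k, c) := Prod.ext i.2 hi
      rw [hy, hk, hi]; ring
    · simp
  rw [h1, Matrix.mulVec_sub, Pi.sub_apply, h]
  beta_reduce
  rw [h2]
  ring

/-- With `A = Σ₀⁻¹ + diag(N / σ²)`, the posterior covariance column `v` solves `A v = e_c`, so `v c
= vᵀ A v`. Dropping the other nonnegative terms of this form gives the second bound; positivity of
the form at `v c • e_c - v` (Cauchy–Schwarz) gives the third. -/
lemma postVar_bounds (hcov : ∀ k, (M.cov k).PosDef) (hvar : ∀ k c, 0 < M.noiseVar k c)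
    (x : ℕ → K × C) (n : ℕ) (k : K) (c : C) :
    0 < M.postVar x n k c ∧
      sampleCount x n (k, c) / M.noiseVar k c * M.postVar x n k c ≤ 1 ∧
      1 ≤ M.postVar x n k c *
        ((M.cov k)⁻¹ c c + sampleCount x n (k, c) / M.noiseVar k c) := by
  set P := (M.cov k)⁻¹ with hP
  have hPd : P.PosDef := (hcov k).inv
  set l : C → ℝ := fun d => sampleCount x n (k, d) / M.noiseVar k d with hl
  have hl0 : ∀ d, 0 ≤ l d := fun d => by positivity
  set v : C → ℝ := fun d => M.postCov x n k d c with hv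
  have hvc : M.postVar x n k c = v c := rfl
  set A : Matrix C C ℝ := P + Matrix.diagonal l with hA
  have hAd : A.PosDef :=
    hPd.add_posSemidef (Matrix.PosSemidef.diagonal fun d => hl0 d)
  have hAv : A *ᵥ v = Pi.single c 1 := by
    funext d
    rw [hA, Matrix.add_mulVec, Pi.add_apply, Matrix.mulVec_diagonal]
    exact precision_postCov hcov hvar x n k c d
  have hvAv : v ⬝ᵥ (A *ᵥ v) = v c := by rw [hAv]; simp
  have hv0 : v ≠ 0 := by
    intro h
    rw [h, Matrix.mulVec_zero] at hAv
    simpa using congrFun hAv c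
  have hpos : 0 < v c := by
    rw [← hvAv]
    simpa using hAd.dotProduct_mulVec_pos hv0
  refine ⟨hpos, ?_, ?_⟩
  · have h1 : l c * v c ^ 2 ≤ v c := by
      have h2 : v ⬝ᵥ (A *ᵥ v) = v ⬝ᵥ (P *ᵥ v) + ∑ d, l d * v d ^ 2 := by
        rw [hA, Matrix.add_mulVec, dotProduct_add]
        congr 1
        simp only [dotProduct, Matrix.mulVec_diagonal]
        exact Finset.sum_congr rfl fun d _ => by ring
      have h3 : 0 ≤ v ⬝ᵥ (P *ᵥ v) := by
        simpa using hPd.posSemidef.dotProduct_mulVec_nonneg v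
      have h4 : l c * v c ^ 2 ≤ ∑ d, l d * v d ^ 2 :=
        Finset.single_le_sum (f := fun d => l d * v d ^ 2)
          (fun d _ => mul_nonneg (hl0 d) (sq_nonneg _)) (Finset.mem_univ c)
      linarith
    have h5 : (l c * v c) * v c ≤ 1 * v c := by nlinarith
    exact le_of_mul_le_mul_right h5 hpos
  · have h0 := hAd.posSemidef.dotProduct_mulVec_nonneg (v c • Pi.single c 1 - v)
    have hsymm : v ⬝ᵥ (A *ᵥ Pi.single c 1) = 1 := by
      have : Aᵀ = A := by simpa using hAd.isHermitian.eq
      rw [Matrix.dotProduct_mulVec, ← Matrix.mulVec_transpose, this, hAv]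
      simp
    have hcc : A c c = P c c + l c := by simp [hA]
    rw [← hcc]
    simp only [star_trivial, Matrix.mulVec_sub, Matrix.mulVec_smul, sub_dotProduct,
      dotProduct_sub, smul_dotProduct, dotProduct_smul, hsymm, hAv, smul_eq_mul] at h0
    simp only [Matrix.mulVec_single_one, single_one_dotProduct, dotProduct_single_one,
      Matrix.col_apply, Pi.single_eq_same] at h0
    have h6 : v c * 1 ≤ v c * (v c * A c c) := by linarith
    exact le_of_mul_le_mul_left h6 hpos

end GPModel

/-! ### Bounds on the error of the posterior mean. -/

section PosteriorError

/-- Cauchy–Schwarz for the inner product of `S⁻¹`: `x c` is the product of `x` with the column `S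
e_c`, whose squared norm is `S c c`. -/
lemma sq_le_diag_mul_precision {C : Type*} [Fintype C] [DecidableEq C] {S : Matrix C C ℝ}
    (hS : S.PosDef) (x : C → ℝ) (c : C) : x c ^ 2 ≤ S c c * (x ⬝ᵥ (S⁻¹ *ᵥ x)) := by
  have hdet : IsUnit S.det := (Matrix.isUnit_iff_isUnit_det _).1 hS.isUnit
  have hpos : 0 < S c c := hS.diag_pos
  set b : C → ℝ := S *ᵥ Pi.single c 1 with hb
  have hPb : S⁻¹ *ᵥ b = Pi.single c 1 := by
    rw [hb, Matrix.mulVec_mulVec, Matrix.nonsing_inv_mul _ hdet, Matrix.one_mulVec]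
  have hbP : b ⬝ᵥ (S⁻¹ *ᵥ x) = x c := by
    have hT : (S⁻¹)ᵀ = S⁻¹ := by simpa using hS.inv.isHermitian.eq
    rw [Matrix.dotProduct_mulVec, ← Matrix.mulVec_transpose, hT, hPb]
    simp
  have h0 := hS.inv.posSemidef.dotProduct_mulVec_nonneg (S c c • x - x c • b)
  simp only [star_trivial, Matrix.mulVec_sub, Matrix.mulVec_smul, sub_dotProduct,
    dotProduct_sub, smul_dotProduct, dotProduct_smul, hPb, hbP, smul_eq_mul,
    dotProduct_single_one] at h0
  have hbc : b c = S c c := by simp [hb]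
  simp only [Pi.sub_apply, Pi.smul_apply, smul_eq_mul, hbc] at h0
  have h1 : S c c * x c ^ 2 ≤ S c c * (S c c * (x ⬝ᵥ (S⁻¹ *ᵥ x))) := by nlinarith
  exact le_of_mul_le_mul_left h1 hpos

lemma abs_mulVec_le {C : Type*} [Fintype C] (P : Matrix C C ℝ) (x : C → ℝ) (c : C) :
    |(P *ᵥ x) c| ≤ (∑ i, ∑ j, |P i j|) * ‖x‖ := by
  calc |(P *ᵥ x) c| ≤ ∑ j, |P c j * x j| := Finset.abs_sum_le_sum_abs _ _
    _ ≤ ∑ j, |P c j| * ‖x‖ := by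
        refine Finset.sum_le_sum fun j _ => ?_
        rw [abs_mul]
        exact mul_le_mul_of_nonneg_left (norm_le_pi_norm x j) (abs_nonneg _)
    _ = (∑ j, |P c j|) * ‖x‖ := by rw [Finset.sum_mul]
    _ ≤ _ := by
        refine mul_le_mul_of_nonneg_right ?_ (norm_nonneg _)
        exact Finset.single_le_sum (f := fun i => ∑ j, |P i j|)
          (fun i _ => Finset.sum_nonneg fun j _ => abs_nonneg _) (Finset.mem_univ c)

/-- Solutions of `(S⁻¹ + diag lₙ) eₙ = hₙ` stay bounded when in every coordinate either `hₙ` is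
bounded, or `lₙ → ∞` and `hₙ = o(lₙ)`. -/
lemma eventually_norm_le_of_precision {C : Type*} [Fintype C] [DecidableEq C] {S : Matrix C C ℝ}
    (hS : S.PosDef) (l h e : ℕ → C → ℝ) (hl : ∀ n c, 0 ≤ l n c)
    (heq : ∀ n c, (S⁻¹ *ᵥ e n) c + l n c * e n c = h n c)
    (hc : ∀ c, (∃ H, ∀ n, |h n c| ≤ H) ∨
      (Tendsto (fun n => l n c) atTop atTop ∧ Tendsto (fun n => h n c / l n c) atTop (nhds 0))) :
    ∃ E, ∀ᶠ n in atTop, ‖e n‖ ≤ E := by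
  set β := ∑ i, ∑ j, |S⁻¹ i j| with hβ
  have hβ0 : 0 ≤ β := Finset.sum_nonneg fun i _ => Finset.sum_nonneg fun j _ => abs_nonneg _
  have hPe : ∀ n c, |(S⁻¹ *ᵥ e n) c| ≤ β * ‖e n‖ := fun n c => abs_mulVec_le _ _ _
  have hH : ∃ H : ℝ, 0 ≤ H ∧ ∀ c, (∀ n, |h n c| ≤ H) ∨
      (Tendsto (fun n => l n c) atTop atTop ∧
        Tendsto (fun n => h n c / l n c) atTop (nhds 0)) := by
    have h1 : ∀ c, ∃ H : ℝ, (∀ n, |h n c| ≤ H) ∨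
      (Tendsto (fun n => l n c) atTop atTop ∧
        Tendsto (fun n => h n c / l n c) atTop (nhds 0)) := fun c => by
      rcases hc c with ⟨H, h1⟩ | h1
      · exact ⟨H, Or.inl h1⟩
      · exact ⟨0, Or.inr h1⟩
    choose H hH using h1
    refine ⟨∑ c, |H c|, Finset.sum_nonneg fun c _ => abs_nonneg _, fun c => (hH c).imp_left ?_⟩
    intro h1 n
    exact (h1 n).trans <| (le_abs_self _).trans <|
      Finset.single_le_sum (f := fun c => |H c|) (fun c _ => abs_nonneg _) (Finset.mem_univ c)
  obtain ⟨H, hH0, hH⟩ := hH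
  set T := (∑ c, S c c) * Fintype.card C with hT
  have hdiag : ∀ c, 0 ≤ S c c := fun c => hS.diag_pos.le
  have hT0 : 0 ≤ T := mul_nonneg (Finset.sum_nonneg fun c _ => hdiag c) (Nat.cast_nonneg _)
  -- `δ` is small enough for the quadratic term `T δ β ‖e‖²` in the energy estimate to be absorbed
  -- into half of `‖e‖²`.
  obtain ⟨δ, hδ0, hδ⟩ : ∃ δ : ℝ, 0 < δ ∧ T * (δ * β) ≤ 1 / 2 := by
    refine ⟨1 / (2 * (T * β + 1)), by positivity, ?_⟩
    have : 0 < T * β + 1 := by positivity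
    rw [show T * (1 / (2 * (T * β + 1)) * β) = (T * β) / (T * β + 1) * (1 / 2) by
      field_simp]
    have : T * β / (T * β + 1) ≤ 1 := by rw [div_le_one this]; linarith
    linarith
  -- Coordinatewise energy bound. Where `h` is bounded, the term `-l e²` is dropped; where `l → ∞`,
  -- solving the equation for `e n c` shows it is at most `δ (1 + ‖e‖)`.
  have hbound : ∀ c, ∀ᶠ n in atTop,
      e n c * (S⁻¹ *ᵥ e n) c ≤ ‖e n‖ * (H + δ * β * (1 + ‖e n‖)) := by
    intro c
    rcases hH c with h1 | ⟨h1, h2⟩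
    · refine Eventually.of_forall fun n => ?_
      have he : |e n c| ≤ ‖e n‖ := norm_le_pi_norm (e n) c
      have h3 : e n c * (S⁻¹ *ᵥ e n) c = e n c * h n c - l n c * e n c ^ 2 := by
        rw [← heq n c]; ring
      have h4 : e n c * h n c ≤ ‖e n‖ * H := by
        refine (le_abs_self _).trans ?_
        rw [abs_mul]
        exact mul_le_mul he (h1 n) (abs_nonneg _) (norm_nonneg _)
      have h5 : 0 ≤ l n c * e n c ^ 2 := mul_nonneg (hl n c) (sq_nonneg _)
      have h6 : 0 ≤ ‖e n‖ * (δ * β * (1 + ‖e n‖)) := by positivity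
      rw [mul_add]
      linarith
    · have h3 : ∀ᶠ n in atTop, |h n c / l n c| < δ := by
        simpa using h2.abs.eventually_lt_const (by simpa using hδ0)
      filter_upwards [h3, h1.eventually_ge_atTop (β / δ + 1)] with n h3 h4
      have hlpos : 0 < l n c := lt_of_lt_of_le (by positivity) h4
      have hβl : β / l n c ≤ δ := by
        rw [div_le_iff₀ hlpos]
        have := (div_le_iff₀ hδ0).1 (show β / δ ≤ l n c by linarith)
        linarith
      have h5 : e n c = h n c / l n c - (S⁻¹ *ᵥ e n) c / l n c := by
        rw [← heq n c]; field_simp; ring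
      have h6 : |e n c| ≤ δ * (1 + ‖e n‖) := by
        rw [h5]
        refine (abs_sub _ _).trans ?_
        have h7 : |(S⁻¹ *ᵥ e n) c / l n c| ≤ δ * ‖e n‖ := by
          rw [abs_div, abs_of_pos hlpos]
          calc _ ≤ β * ‖e n‖ / l n c := div_le_div_of_nonneg_right (hPe n c) hlpos.le
            _ = β / l n c * ‖e n‖ := by ring
            _ ≤ _ := mul_le_mul_of_nonneg_right hβl (norm_nonneg _)
        linarith
      have h8 : e n c * (S⁻¹ *ᵥ e n) c ≤ δ * (1 + ‖e n‖) * (β * ‖e n‖) := by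
        refine (le_abs_self _).trans ?_
        rw [abs_mul]
        exact mul_le_mul h6 (hPe n c) (abs_nonneg _) (by positivity)
      have h9 : 0 ≤ ‖e n‖ * H := by positivity
      nlinarith
  refine ⟨2 * (T * (H + δ * β)), ?_⟩
  filter_upwards [eventually_all.2 hbound] with n hn
  set x := ‖e n‖ with hx
  have hx0 : 0 ≤ x := norm_nonneg _
  have hquad : e n ⬝ᵥ (S⁻¹ *ᵥ e n) ≤ Fintype.card C * (x * (H + δ * β * (1 + x))) := by
    calc e n ⬝ᵥ (S⁻¹ *ᵥ e n) ≤ ∑ _c : C, x * (H + δ * β * (1 + x)) :=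
          Finset.sum_le_sum fun c _ => hn c
      _ = _ := by simp
  have hq0 : 0 ≤ e n ⬝ᵥ (S⁻¹ *ᵥ e n) := by
    simpa using hS.inv.posSemidef.dotProduct_mulVec_nonneg (e n)
  have hsq : x ^ 2 ≤ T * (x * (H + δ * β * (1 + x))) := by
    have h1 : x ≤ √((∑ c, S c c) * (e n ⬝ᵥ (S⁻¹ *ᵥ e n))) := by
      refine (pi_norm_le_iff_of_nonneg (Real.sqrt_nonneg _)).2 fun c => ?_
      refine Real.le_sqrt_of_sq_le ?_
      rw [Real.norm_eq_abs, sq_abs]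
      refine (sq_le_diag_mul_precision hS (e n) c).trans ?_
      exact mul_le_mul_of_nonneg_right
        (Finset.single_le_sum (f := fun c => S c c) (fun c _ => hdiag c) (Finset.mem_univ c)) hq0
    have hs0 : 0 ≤ ∑ c, S c c := Finset.sum_nonneg fun c _ => hdiag c
    calc x ^ 2 ≤ √((∑ c, S c c) * (e n ⬝ᵥ (S⁻¹ *ᵥ e n))) ^ 2 := by gcongr
      _ = (∑ c, S c c) * (e n ⬝ᵥ (S⁻¹ *ᵥ e n)) := Real.sq_sqrt (mul_nonneg hs0 hq0)
      _ ≤ (∑ c, S c c) * (Fintype.card C * (x * (H + δ * β * (1 + x)))) :=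
          mul_le_mul_of_nonneg_left hquad hs0
      _ = _ := by rw [hT]; ring
  rcases hx0.eq_or_lt with h0 | h0
  · rw [← h0]; positivity
  · have h1 : x ≤ T * (H + δ * β * (1 + x)) := by
      have : x * x ≤ x * (T * (H + δ * β * (1 + x))) := by linarith
      exact le_of_mul_le_mul_left this h0
    nlinarith

variable {K C : Type*} [DecidableEq K] [DecidableEq C] [Fintype C] {M : GPModel K C}

/-- The observations recorded along a path, when `e j k c` is the noise in the `j`-th observation
of `(k, c)`. -/
def IsObserved (F : K → C → ℝ) (e : ℕ → K → C → ℝ) (x : ℕ → K × C) (y : ℕ → ℝ) : Prop :=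
  ∀ i, y i = F (x i).1 (x i).2 + e (sampleCount x i (x i)) (x i).1 (x i).2

/-- The error equation first bounds the error at all contexts, including those sampled finitely
often. Read again with this bound, it says that the posterior mean equals `F` plus the empirical
noise average up to `O(1 / N)`, which is precise enough to see fluctuations of order `1 / √N`. -/
lemma eventually_postMean_error_le (hcov : ∀ k, (M.cov k).PosDef)
    (hvar : ∀ k c, 0 < M.noiseVar k c) {F : K → C → ℝ} {e : ℕ → K → C → ℝ} {x : ℕ → K × C}
    {y : ℕ → ℝ} (hy : IsObserved F e x y)
    (hlln : ∀ a, Tendsto (fun N : ℕ => noiseSum e a N / N) atTop (nhds 0)) (k : K) :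
    ∃ B, ∀ᶠ n in atTop, ∀ c, |M.postMean x y n k c - F k c| ≤ B ∧
      |sampleCount x n (k, c) * (M.postMean x y n k c - F k c) -
        noiseSum e (k, c) (sampleCount x n (k, c))| ≤ B := by
  have hv : ∀ c, (0 : ℝ) < M.noiseVar k c := fun c => by exact_mod_cast hvar k c
  set g : C → ℝ := (M.cov k)⁻¹ *ᵥ fun d => F k d - M.mean k d with hg
  have heq := fun n c => GPModel.precision_postMean hcov hvar F e x y hy n k c
  obtain ⟨E, hE⟩ := eventually_norm_le_of_precision (hcov k)
    (fun n c => sampleCount x n (k, c) / M.noiseVar k c)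
    (fun n c => noiseSum e (k, c) (sampleCount x n (k, c)) / M.noiseVar k c - g c)
    (fun n d => M.postMean x y n k d - F k d) (fun n c => by positivity) heq (by
      intro c
      rcases sampleCount_tendsto_or_bounded x (k, c) with h | ⟨b, hb⟩
      · have hR : Tendsto (fun n => (sampleCount x n (k, c) : ℝ)) atTop atTop :=
          tendsto_natCast_atTop_atTop.comp h
        have h1 : Tendsto (fun n => (sampleCount x n (k, c) : ℝ) / M.noiseVar k c) atTop atTop :=
          hR.atTop_div_const (hv c)
        refine Or.inr ⟨h1, ?_⟩
        have h2 := ((hlln (k, c)).comp h).sub (h1.const_div_atTop (g c))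
        rw [sub_zero] at h2
        refine h2.congr fun n => ?_
        simp only [Function.comp_apply]
        rw [sub_div]
        congr 1
        rw [div_div_div_cancel_right₀ (hv c).ne']
      -- With counts at most `b`, the noise sum takes finitely many values.
      · refine Or.inl ⟨(∑ N ∈ Finset.range (b + 1), |noiseSum e (k, c) N|) / M.noiseVar k c +
          |g c|, fun n => (abs_sub _ _).trans ?_⟩
        rw [abs_div, abs_of_pos (hv c)]
        gcongr
        exact Finset.single_le_sum (f := fun N => |noiseSum e (k, c) N|)
          (fun _ _ => abs_nonneg _) (Finset.mem_range.2 (Nat.lt_succ_of_le (hb n))))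
  set β := ∑ i, ∑ j, |(M.cov k)⁻¹ i j| with hβ
  have hβ0 : 0 ≤ β := Finset.sum_nonneg fun i _ => Finset.sum_nonneg fun j _ => abs_nonneg _
  refine ⟨max E (∑ c, M.noiseVar k c * (|g c| + β * |E|)), ?_⟩
  filter_upwards [hE] with n hn c
  refine ⟨le_max_of_le_left ((norm_le_pi_norm (fun d => M.postMean x y n k d - F k d) c).trans hn),
    le_max_of_le_right ?_⟩
  have h1 : sampleCount x n (k, c) * (M.postMean x y n k c - F k c) -
      noiseSum e (k, c) (sampleCount x n (k, c)) =
      -(M.noiseVar k c * (g c + ((M.cov k)⁻¹ *ᵥ fun d => M.postMean x y n k d - F k d) c)) := by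
    have := heq n c
    have hne := (hv c).ne'
    field_simp at this
    linarith
  rw [h1, abs_neg, abs_mul, abs_of_pos (hv c)]
  have h2 : |g c + ((M.cov k)⁻¹ *ᵥ fun d => M.postMean x y n k d - F k d) c| ≤
      |g c| + β * |E| := by
    refine (abs_add_le _ _).trans (add_le_add le_rfl ((abs_mulVec_le _ _ _).trans ?_))
    exact mul_le_mul_of_nonneg_left (hn.trans (le_abs_self _)) hβ0
  refine (mul_le_mul_of_nonneg_left h2 (hv c).le).trans ?_
  exact Finset.single_le_sum (f := fun c => (M.noiseVar k c : ℝ) * (|g c| + β * |E|))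
    (fun c _ => mul_nonneg (hv c).le (by positivity)) (Finset.mem_univ c)

lemma tendsto_postMean (hcov : ∀ k, (M.cov k).PosDef)
    (hvar : ∀ k c, 0 < M.noiseVar k c) {F : K → C → ℝ} {e : ℕ → K → C → ℝ} {x : ℕ → K × C}
    {y : ℕ → ℝ} (hy : IsObserved F e x y)
    (hlln : ∀ a, Tendsto (fun N : ℕ => noiseSum e a N / N) atTop (nhds 0)) {k : K} {c : C}
    (h : Tendsto (fun n => sampleCount x n (k, c)) atTop atTop) :
    Tendsto (fun n => M.postMean x y n k c) atTop (nhds (F k c)) := by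
  obtain ⟨B, hB⟩ := eventually_postMean_error_le hcov hvar hy hlln k
  have hR : Tendsto (fun n => (sampleCount x n (k, c) : ℝ)) atTop atTop :=
    tendsto_natCast_atTop_atTop.comp h
  have h1 := ((hlln (k, c)).comp h).abs.add (hR.const_div_atTop B)
  rw [tendsto_iff_dist_tendsto_zero]
  rw [abs_zero, add_zero] at h1
  refine squeeze_zero' (Eventually.of_forall fun _ => dist_nonneg) ?_ h1
  filter_upwards [hB, hR.eventually_gt_atTop 0] with n hn hpos
  have h2 := (hn c).2
  rw [Real.dist_eq]
  simp only [Function.comp_apply]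
  rw [abs_div, abs_of_pos hpos, ← add_div, le_div_iff₀ hpos]
  have h3 := abs_sub_abs_le_abs_sub (sampleCount x n (k, c) * (M.postMean x y n k c - F k c))
    (noiseSum e (k, c) (sampleCount x n (k, c)))
  rw [abs_mul, abs_of_pos hpos] at h3
  linarith

end PosteriorError

/-! ### Deterministic analysis: on a regular path every pair is sampled infinitely often. -/

/-- The paths of GP-C-OCBA on which the noise obeys the law of large numbers and, for every pair,
has arbitrarily deep downward excursions while the noise at the other pairs stays moderate. -/
structure IsRegularPath {K C : Type*} [DecidableEq K] [DecidableEq C] [Fintype K]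
    (M : GPModel K C) (F : K → C → ℝ) (e : ℕ → K → C → ℝ) (N₀ : ℕ)
    (x : ℕ → K × C) (y : ℕ → ℝ) (b : ℕ → C → K) : Prop where
  posDef : ∀ k, (M.cov k).PosDef
  noiseVar_pos : ∀ k c, 0 < M.noiseVar k c
  observed : IsObserved F e x y
  predictedBest : ∀ n, M.IsPredictedBest x y n (b n)
  step : ∀ n, N₀ ≤ n → M.IsOCBAStep x y n (b n) (x n)
  lln : ∀ a, Tendsto (fun N : ℕ => noiseSum e a N / N) atTop (nhds 0)
  excursion : ∀ a (Q : ℕ), ∃ᶠ L : ℕ in atTop, noiseSum e a L ≤ -Q * √L ∧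
    ∀ a', a' ≠ a → ∀ N : ℕ, -(√L + N / √L) ≤ noiseSum e a' N

/-- The pair `a` is sampled infinitely often. -/
def SampledInfOften {K C : Type*} [DecidableEq K] [DecidableEq C] (x : ℕ → K × C) (a : K × C) :
    Prop :=
  Tendsto (fun n => sampleCount x n a) atTop atTop

section Counting

variable {K C : Type*} [DecidableEq K] [DecidableEq C] {x : ℕ → K × C} {a : K × C}

lemma SampledInfOften.frequently (h : SampledInfOften x a) : ∃ᶠ n in atTop, x n = a := by
  intro h1
  obtain ⟨T, hT⟩ := eventually_atTop.1 h1
  have hconst : ∀ n, T ≤ n → sampleCount x n a = sampleCount x T a := by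
    intro n hn
    induction n, hn using Nat.le_induction with
    | base => rfl
    | succ n hn ih => rw [sampleCount_succ, if_neg (hT n hn), ih, add_zero]
  obtain ⟨n, hn, hn'⟩ := ((h.eventually_gt_atTop (sampleCount x T a)).and
    (eventually_ge_atTop T)).exists
  rw [hconst n hn'] at hn
  exact lt_irrefl _ hn

lemma eventually_ne_of_not_sampledInfOften (h : ¬ SampledInfOften x a) :
    ∀ᶠ n in atTop, x n ≠ a := by
  obtain ⟨b, hb⟩ := (sampleCount_tendsto_or_bounded x a).resolve_left h
  by_contra h1
  rw [not_eventually] at h1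
  refine h (tendsto_atTop_atTop_of_monotone (sampleCount_mono x a) fun m => ?_)
  induction m with
  | zero => exact ⟨0, Nat.zero_le _⟩
  | succ m ih =>
    obtain ⟨n, hn⟩ := ih
    obtain ⟨n', hn', hx⟩ := frequently_atTop.1 h1 n
    refine ⟨n' + 1, ?_⟩
    rw [sampleCount_succ, if_pos (not_not.1 hx)]
    exact Nat.succ_le_succ (hn.trans (sampleCount_mono x a hn'))

/-- Counts increase by at most one per step and so skip no value; this gives a time at which a
prescribed excursion level is reached. -/
lemma SampledInfOften.exists_eq (h : SampledInfOften x a) {T L : ℕ}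
    (hL : sampleCount x T a ≤ L) : ∃ n, T ≤ n ∧ sampleCount x n a = L := by
  by_contra hcon
  push Not at hcon
  have hle : ∀ n, T ≤ n → sampleCount x n a ≤ L := by
    intro n hn
    induction n, hn using Nat.le_induction with
    | base => exact hL
    | succ n hn ih =>
      have := hcon n hn
      rw [sampleCount_succ]
      split_ifs <;> omega
  obtain ⟨n, hn, hn'⟩ := ((h.eventually_gt_atTop L).and (eventually_ge_atTop T)).exists
  exact absurd (hle n hn') (not_le.2 hn)

end Counting

namespace IsRegularPath

variable {K C : Type*} [DecidableEq K] [DecidableEq C] [Fintype K]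
  {M : GPModel K C} {F : K → C → ℝ} {e : ℕ → K → C → ℝ} {N₀ : ℕ}
  {x : ℕ → K × C} {y : ℕ → ℝ} {b : ℕ → C → K}

/-- The allocation ratio `N_n(k, c) / Σ_n(k, c)`. -/
noncomputable def ratio (M : GPModel K C) (x : ℕ → K × C) (n : ℕ) (k : K) (c : C) : ℝ :=
  sampleCount x n (k, c) / M.postVar x n k c

lemma noiseVar_pos' (h : IsRegularPath M F e N₀ x y b) (k : K) (c : C) :
    (0 : ℝ) < M.noiseVar k c := by exact_mod_cast h.noiseVar_pos k c

/-- The sampling rule, with the comparison of `ψ⁽¹⁾` and `ψ⁽²⁾` in terms of `ratio`. -/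
lemma step_cases (h : IsRegularPath M F e N₀ x y b) {n : ℕ} (hn : N₀ ≤ n) (hn0 : 0 < n) :
    ∃ k c, k ≠ b n c ∧
      (∀ k' c', k' ≠ b n c' → M.zeta x y n (b n) k c ≤ M.zeta x y n (b n) k' c') ∧
      ((x n = (b n c, c) ∧
        ratio M x n (b n c) c < ∑ k' ∈ Finset.univ.filter (· ≠ b n c), ratio M x n k' c) ∨
       (x n = (k, c) ∧
        ∑ k' ∈ Finset.univ.filter (· ≠ b n c), ratio M x n k' c ≤ ratio M x n (b n c) c)) := by
  obtain ⟨k, c, hk, hmin, hnext⟩ := h.step n hn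
  refine ⟨k, c, hk, hmin, ?_⟩
  have hnR : (0 : ℝ) < n := by exact_mod_cast hn0
  have h1 : ∀ k', sampleFrac x n k' c / M.postVar x n k' c = ratio M x n k' c / n := fun k' => by
    rw [sampleFrac, ratio, div_right_comm]
  have hiff : M.psi₁ x n (b n) c < M.psi₂ x n (b n) c ↔
      ratio M x n (b n c) c < ∑ k' ∈ Finset.univ.filter (· ≠ b n c), ratio M x n k' c := by
    rw [GPModel.psi₁, GPModel.psi₂, h1, Finset.sum_congr rfl fun k' _ => h1 k',
      ← Finset.sum_div, div_lt_div_iff_of_pos_right hnR]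
  split_ifs at hnext with hc
  · exact Or.inl ⟨hnext, hiff.1 hc⟩
  · exact Or.inr ⟨hnext, not_lt.1 (mt hiff.2 hc)⟩

variable [Fintype C]

lemma postVar_pos (h : IsRegularPath M F e N₀ x y b) (n : ℕ) (k : K) (c : C) :
    0 < M.postVar x n k c :=
  (GPModel.postVar_bounds h.posDef h.noiseVar_pos x n k c).1

lemma ratio_nonneg (h : IsRegularPath M F e N₀ x y b) (n : ℕ) (k : K) (c : C) :
    0 ≤ ratio M x n k c :=
  div_nonneg (Nat.cast_nonneg _) (h.postVar_pos n k c).le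

lemma count_mul_postVar_le (h : IsRegularPath M F e N₀ x y b) (n : ℕ) (k : K) (c : C) :
    sampleCount x n (k, c) * M.postVar x n k c ≤ M.noiseVar k c := by
  have h1 := (GPModel.postVar_bounds h.posDef h.noiseVar_pos x n k c).2.1
  rw [div_mul_eq_mul_div, div_le_one (h.noiseVar_pos' k c)] at h1
  exact h1

lemma inv_postVar_le (h : IsRegularPath M F e N₀ x y b) (n : ℕ) (k : K) (c : C) :
    (M.postVar x n k c)⁻¹ ≤ (M.cov k)⁻¹ c c + sampleCount x n (k, c) / M.noiseVar k c := by
  rw [inv_le_iff_one_le_mul₀ (h.postVar_pos n k c), mul_comm]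
  exact (GPModel.postVar_bounds h.posDef h.noiseVar_pos x n k c).2.2

/-- Together with `ratio_le` this shows that the allocation ratio is of order `N²`. -/
lemma count_sq_le (h : IsRegularPath M F e N₀ x y b) (n : ℕ) (k : K) (c : C) :
    (sampleCount x n (k, c) : ℝ) ^ 2 ≤ M.noiseVar k c * ratio M x n k c := by
  have h1 := h.count_mul_postVar_le n k c
  have h2 := h.postVar_pos n k c
  rw [ratio, mul_div_assoc', le_div_iff₀ h2]
  have h3 : (0 : ℝ) ≤ sampleCount x n (k, c) := Nat.cast_nonneg _
  nlinarith

lemma ratio_le (h : IsRegularPath M F e N₀ x y b) (n : ℕ) (k : K) (c : C) :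
    ratio M x n k c ≤ sampleCount x n (k, c) *
      ((M.cov k)⁻¹ c c + sampleCount x n (k, c) / M.noiseVar k c) := by
  rw [ratio, div_eq_mul_inv]
  exact mul_le_mul_of_nonneg_left (h.inv_postVar_le n k c) (Nat.cast_nonneg _)

lemma precision_diag_pos (h : IsRegularPath M F e N₀ x y b) (k : K) (c : C) :
    0 < (M.cov k)⁻¹ c c := (h.posDef k).inv.diag_pos

lemma ratio_bounded (h : IsRegularPath M F e N₀ x y b) {k : K} {c : C}
    (ha : ¬ SampledInfOften x (k, c)) : ∃ R, ∀ n, ratio M x n k c ≤ R := by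
  obtain ⟨B, hB⟩ := (sampleCount_tendsto_or_bounded x (k, c)).resolve_left ha
  have hv := h.noiseVar_pos' k c
  have hp := h.precision_diag_pos k c
  refine ⟨B * ((M.cov k)⁻¹ c c + B / M.noiseVar k c), fun n => (h.ratio_le n k c).trans ?_⟩
  have : (sampleCount x n (k, c) : ℝ) ≤ B := by exact_mod_cast hB n
  gcongr

lemma tendsto_ratio (h : IsRegularPath M F e N₀ x y b) {k : K} {c : C}
    (ha : SampledInfOften x (k, c)) : Tendsto (fun n => ratio M x n k c) atTop atTop := by
  have hv := h.noiseVar_pos' k c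
  have hR : Tendsto (fun n => (sampleCount x n (k, c) : ℝ)) atTop atTop :=
    tendsto_natCast_atTop_atTop.comp ha
  refine tendsto_atTop_mono (fun n => ?_)
    ((tendsto_pow_atTop two_ne_zero).comp hR |>.atTop_div_const hv)
  simp only [Function.comp_apply]
  rw [div_le_iff₀ hv, mul_comm]
  exact h.count_sq_le n k c

lemma tendsto_postVar (h : IsRegularPath M F e N₀ x y b) {k : K} {c : C}
    (ha : SampledInfOften x (k, c)) :
    Tendsto (fun n => M.postVar x n k c) atTop (nhds 0) := by
  have hR : Tendsto (fun n => (sampleCount x n (k, c) : ℝ)) atTop atTop :=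
    tendsto_natCast_atTop_atTop.comp ha
  refine squeeze_zero' (Eventually.of_forall fun n => (h.postVar_pos n k c).le) ?_
    (hR.const_div_atTop (M.noiseVar k c : ℝ))
  filter_upwards [hR.eventually_gt_atTop 0] with n hn
  rw [le_div_iff₀ hn, mul_comm]
  exact h.count_mul_postVar_le n k c

lemma tendsto_mean (h : IsRegularPath M F e N₀ x y b) {k : K} {c : C}
    (ha : SampledInfOften x (k, c)) :
    Tendsto (fun n => M.postMean x y n k c) atTop (nhds (F k c)) :=
  tendsto_postMean h.posDef h.noiseVar_pos h.observed h.lln ha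

lemma mean_error (h : IsRegularPath M F e N₀ x y b) :
    ∃ B, 0 ≤ B ∧ ∀ᶠ n in atTop, ∀ k c, |M.postMean x y n k c - F k c| ≤ B ∧
      |sampleCount x n (k, c) * (M.postMean x y n k c - F k c) -
        noiseSum e (k, c) (sampleCount x n (k, c))| ≤ B := by
  choose B hB using fun k =>
    eventually_postMean_error_le h.posDef h.noiseVar_pos h.observed h.lln k
  refine ⟨∑ k, |B k|, Finset.sum_nonneg fun k _ => abs_nonneg _, ?_⟩
  filter_upwards [eventually_all.2 hB] with n hn k c
  have h1 : B k ≤ ∑ k, |B k| := (le_abs_self _).trans <|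
    Finset.single_le_sum (f := fun k => |B k|) (fun k _ => abs_nonneg _) (Finset.mem_univ k)
  exact ⟨(hn k c).1.trans h1, (hn k c).2.trans h1⟩

/-- If some pair is sampled finitely often, the minimum of `ζ` stays bounded. -/
lemma zeta_bounded [Nontrivial K] (h : IsRegularPath M F e N₀ x y b) {a : K × C}
    (ha : ¬ SampledInfOften x a) :
    ∃ Z, 0 ≤ Z ∧ ∀ᶠ n in atTop, ∃ k c, k ≠ b n c ∧ M.zeta x y n (b n) k c ≤ Z := by
  obtain ⟨k₀, c₀⟩ := a
  obtain ⟨B, hB0, hB⟩ := h.mean_error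
  obtain ⟨m, hm⟩ := (sampleCount_tendsto_or_bounded x (k₀, c₀)).resolve_left ha
  set D := B + ∑ k, |F k c₀| with hD
  have hD0 : 0 ≤ D := add_nonneg hB0 (Finset.sum_nonneg fun k _ => abs_nonneg _)
  set q := (M.cov k₀)⁻¹ c₀ c₀ + m / M.noiseVar k₀ c₀ with hq
  have hv := h.noiseVar_pos' k₀ c₀
  have hp := h.precision_diag_pos k₀ c₀
  have hq0 : 0 < q := by positivity
  refine ⟨(2 * D) ^ 2 * q, by positivity, ?_⟩
  filter_upwards [hB] with n hn
  have hmean : ∀ k, |M.postMean x y n k c₀| ≤ D := by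
    intro k
    have h1 := (hn k c₀).1
    have h2 : |F k c₀| ≤ ∑ k, |F k c₀| :=
      Finset.single_le_sum (f := fun k => |F k c₀|) (fun k _ => abs_nonneg _) (Finset.mem_univ k)
    have h3 := abs_sub_abs_le_abs_sub (M.postMean x y n k c₀) (F k c₀)
    linarith
  have hs : (M.postVar x n k₀ c₀)⁻¹ ≤ q := by
    refine (h.inv_postVar_le n k₀ c₀).trans ?_
    have : (sampleCount x n (k₀, c₀) : ℝ) ≤ m := by exact_mod_cast hm n
    rw [hq]
    gcongr
  -- One of the two alternatives compared is `k₀`, whose variance alone keeps the denominator of ζ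
  -- away from `0`.
  have key : ∀ k, k₀ = b n c₀ ∨ k = k₀ → M.zeta x y n (b n) k c₀ ≤ (2 * D) ^ 2 * q := by
    intro k hk
    have h1 : M.postVar x n k₀ c₀ ≤ M.postVar x n (b n c₀) c₀ + M.postVar x n k c₀ := by
      have h2 := h.postVar_pos n (b n c₀) c₀
      have h3 := h.postVar_pos n k c₀
      rcases hk with hk | hk
      · rw [← hk]; linarith
      · rw [hk]; linarith
    have h4 : (M.postMean x y n (b n c₀) c₀ - M.postMean x y n k c₀) ^ 2 ≤ (2 * D) ^ 2 := by
      rw [sq_le_sq, abs_of_nonneg (by positivity : 0 ≤ 2 * D)]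
      refine (abs_sub _ _).trans ?_
      linarith [hmean (b n c₀), hmean k]
    rw [GPModel.zeta, div_eq_mul_inv]
    have hpos := h.postVar_pos n k₀ c₀
    have h5 : (M.postVar x n (b n c₀) c₀ + M.postVar x n k c₀)⁻¹ ≤ q :=
      (inv_anti₀ hpos h1).trans hs
    exact mul_le_mul h4 h5 (inv_nonneg.2 (hpos.le.trans h1)) (by positivity)
  by_cases hb : k₀ = b n c₀
  · obtain ⟨k₁, hk₁⟩ := exists_ne k₀
    exact ⟨k₁, c₀, by rwa [← hb], key k₁ (Or.inl hb)⟩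
  · exact ⟨k₀, c₀, hb, key k₀ (Or.inr rfl)⟩

/-- The sampling rule at late times, when some pair is sampled finitely often. -/
lemma late_step [Nontrivial K] (h : IsRegularPath M F e N₀ x y b) {a : K × C}
    (ha : ¬ SampledInfOften x a) :
    ∃ Z, 0 ≤ Z ∧ ∀ᶠ n in atTop, ∃ k c, x n = (k, c) ∧ SampledInfOften x (k, c) ∧
      SampledInfOften x (b n c, c) ∧ F k c = F (b n c) c ∧
      ((k = b n c ∧ ratio M x n k c < ∑ j ∈ Finset.univ.filter (· ≠ k), ratio M x n j c) ∨
       (k ≠ b n c ∧ ratio M x n k c ≤ ratio M x n (b n c) c ∧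
        (M.postMean x y n (b n c) c - M.postMean x y n k c) ^ 2 ≤
          Z * (M.postVar x n (b n c) c + M.postVar x n k c))) := by
  obtain ⟨Z, hZ0, hZ⟩ := h.zeta_bounded ha
  refine ⟨Z, hZ0, ?_⟩
  have h1 : ∀ᶠ n in atTop, SampledInfOften x (x n) := by
    have : ∀ a : K × C, ∀ᶠ n in atTop, x n = a → SampledInfOften x a := fun a => by
      by_cases ha : SampledInfOften x a
      · exact Eventually.of_forall fun _ _ => ha
      · filter_upwards [eventually_ne_of_not_sampledInfOften ha] with n hn hn'
        exact absurd hn' hn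
    filter_upwards [eventually_all.2 this] with n hn
    exact hn _ rfl
  -- Used to show that when a challenger is sampled, the current best is itself sampled infinitely
  -- often: its ratio is at least the challenger's.
  have h2 : ∀ᶠ n in atTop, ∀ k k' c, SampledInfOften x (k, c) → ¬ SampledInfOften x (k', c) →
      ratio M x n k' c < ratio M x n k c := by
    refine eventually_all.2 fun k => eventually_all.2 fun k' => eventually_all.2 fun c => ?_
    by_cases hk : SampledInfOften x (k, c) ∧ ¬ SampledInfOften x (k', c)
    · obtain ⟨R, hR⟩ := h.ratio_bounded hk.2
      filter_upwards [(h.tendsto_ratio hk.1).eventually_gt_atTop R] with n hn _ _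
      exact (hR n).trans_lt hn
    · exact Eventually.of_forall fun n h3 h4 => absurd ⟨h3, h4⟩ hk
  -- For different rewards, the variances vanish while the squared mean gap has a positive limit, so
  -- ζ exceeds `Z`.
  have h3 : ∀ᶠ n in atTop, ∀ k k' c, SampledInfOften x (k, c) → SampledInfOften x (k', c) →
      F k c ≠ F k' c → Z * (M.postVar x n k' c + M.postVar x n k c) <
        (M.postMean x y n k' c - M.postMean x y n k c) ^ 2 := by
    refine eventually_all.2 fun k => eventually_all.2 fun k' => eventually_all.2 fun c => ?_
    by_cases hk : SampledInfOften x (k, c) ∧ SampledInfOften x (k', c) ∧ F k c ≠ F k' c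
    · obtain ⟨hk1, hk2, hk3⟩ := hk
      have l1 := ((h.tendsto_postVar hk2).add (h.tendsto_postVar hk1)).const_mul Z
      have l2 := ((h.tendsto_mean hk2).sub (h.tendsto_mean hk1)).pow 2
      have h4 : Z * (0 + 0) < (F k' c - F k c) ^ 2 := by
        have : F k' c - F k c ≠ 0 := sub_ne_zero.2 hk3.symm
        have := pow_pos (abs_pos.2 this) 2
        rw [sq_abs] at this
        linarith
      filter_upwards [l1.eventually_lt l2 h4] with n hn _ _ _
      exact hn
    · exact Eventually.of_forall fun n h4 h5 h6 => absurd ⟨h4, h5, h6⟩ hk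
  filter_upwards [hZ, h1, h2, h3, eventually_ge_atTop N₀, eventually_gt_atTop 0]
    with n hZ h1 h2 h3 hn hn0
  obtain ⟨k, c, hk, hmin, ⟨hx, hr⟩ | ⟨hx, hr⟩⟩ := h.step_cases hn hn0
  · rw [hx] at h1
    exact ⟨b n c, c, hx, h1, h1, rfl, Or.inl ⟨rfl, hr⟩⟩
  · rw [hx] at h1
    have hrk : ratio M x n k c ≤ ratio M x n (b n c) c :=
      (Finset.single_le_sum (f := fun j => ratio M x n j c) (fun j _ => h.ratio_nonneg n j c)
        (by simpa using hk)).trans hr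
    have hb : SampledInfOften x (b n c, c) := by
      by_contra hb
      exact absurd hrk (not_le.2 (h2 k (b n c) c h1 hb))
    obtain ⟨k', c', hk', hle⟩ := hZ
    have hz := (hmin k' c' hk').trans hle
    rw [GPModel.zeta, div_le_iff₀ (add_pos (h.postVar_pos n _ c) (h.postVar_pos n k c))] at hz
    refine ⟨k, c, hx, h1, hb, ?_, Or.inr ⟨hk, hrk, hz⟩⟩
    by_contra hF
    exact absurd hz (not_le.2 (h3 k (b n c) c h1 hb hF))

/-- At a context where sampling goes on, all pairs sampled infinitely often are tied. -/
lemma reward_eq [Nontrivial K] (h : IsRegularPath M F e N₀ x y b) {a : K × C}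
    (ha : ¬ SampledInfOften x a) {k k' : K} {c : C} (hk : SampledInfOften x (k, c))
    (hk' : SampledInfOften x (k', c)) : F k c = F k' c := by
  have key : ∀ k k', SampledInfOften x (k, c) → SampledInfOften x (k', c) →
      F k' c ≤ F k c := by
    intro k k' hk hk'
    obtain ⟨Z, -, hZ⟩ := h.late_step ha
    have h1 : ∀ᶠ n in atTop, ∀ j, SampledInfOften x (j, c) → F j c < F k' c →
        M.postMean x y n j c < M.postMean x y n k' c := by
      refine eventually_all.2 fun j => ?_
      by_cases hj : SampledInfOften x (j, c) ∧ F j c < F k' c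
      · filter_upwards [(h.tendsto_mean hj.1).eventually_lt (h.tendsto_mean hk') hj.2]
          with n hn _ _
        exact hn
      · exact Eventually.of_forall fun n h2 h3 => absurd ⟨h2, h3⟩ hj
    -- A late time at which `k` is sampled: the predicted best `j` is tied with `k`, and its
    -- posterior mean is at least that of `k'`.
    obtain ⟨n, hn, ⟨j, c', hx, -, hb, hF, -⟩, h1⟩ :=
      (hk.frequently.and_eventually (hZ.and h1)).exists
    rw [hn, Prod.mk.injEq] at hx
    obtain ⟨rfl, rfl⟩ := hx
    rw [hF]
    by_contra hlt
    exact absurd (h.predictedBest n c k') (not_le.2 (h1 _ hb (not_le.1 hlt)))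
  exact le_antisymm (key _ _ hk' hk) (key _ _ hk hk')

/-- Ratios are of order `N²`, so comparable ratios mean comparable counts. The factor `Fintype.card
K` leaves room for the pigeonhole argument on ψ⁽²⁾. -/
lemma count_le_of_ratio_le (h : IsRegularPath M F e N₀ x y b) :
    ∃ Γ : ℝ, 0 < Γ ∧ ∀ n k j c, ratio M x n k c ≤ Fintype.card K * ratio M x n j c →
      sampleCount x n (k, c) ≤ Γ * sampleCount x n (j, c) := by
  set V := ∑ k, ∑ c, (M.noiseVar k c : ℝ) with hV
  set U := ∑ k, ∑ c, ((M.cov k)⁻¹ c c + 1 / M.noiseVar k c) with hU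
  have hVle : ∀ k c, (M.noiseVar k c : ℝ) ≤ V := fun k c =>
    (Finset.single_le_sum (f := fun c => (M.noiseVar k c : ℝ)) (fun c _ => NNReal.coe_nonneg _)
      (Finset.mem_univ c)).trans <| Finset.single_le_sum
        (f := fun k => ∑ c, (M.noiseVar k c : ℝ))
        (fun k _ => Finset.sum_nonneg fun c _ => NNReal.coe_nonneg _) (Finset.mem_univ k)
  have hu0 : ∀ k c, 0 ≤ (M.cov k)⁻¹ c c + 1 / M.noiseVar k c := fun k c =>
    add_nonneg (h.precision_diag_pos k c).le (by positivity)
  have hUle : ∀ k c, (M.cov k)⁻¹ c c + 1 / M.noiseVar k c ≤ U := fun k c =>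
    (Finset.single_le_sum (f := fun c => (M.cov k)⁻¹ c c + 1 / (M.noiseVar k c : ℝ))
      (fun c _ => hu0 k c) (Finset.mem_univ c)).trans <| Finset.single_le_sum
        (f := fun k => ∑ c, ((M.cov k)⁻¹ c c + 1 / (M.noiseVar k c : ℝ)))
        (fun k _ => Finset.sum_nonneg fun c _ => hu0 k c) (Finset.mem_univ k)
  have hV0 : 0 ≤ V := Finset.sum_nonneg fun k _ => Finset.sum_nonneg fun c _ => NNReal.coe_nonneg _
  have hU0 : 0 ≤ U := Finset.sum_nonneg fun k _ => Finset.sum_nonneg fun c _ => hu0 k c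
  set G := V * (Fintype.card K * U) with hG
  have hG0 : 0 ≤ G := by positivity
  -- The squared counts compare with constant `G`, and `G ≤ (G + 1)²` avoids a square root.
  refine ⟨G + 1, by positivity, fun n k j c hr => ?_⟩
  set Nk : ℝ := ((sampleCount x n (k, c) : ℕ) : ℝ) with hNk
  set Nj : ℝ := ((sampleCount x n (j, c) : ℕ) : ℝ) with hNj
  have hNj0 : 0 ≤ Nj := Nat.cast_nonneg _
  have hNj1 : Nj ≤ Nj ^ 2 := by
    rw [hNj]; exact_mod_cast Nat.le_self_pow two_ne_zero _
  have h1 : ratio M x n j c ≤ U * Nj ^ 2 := by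
    refine (h.ratio_le n j c).trans ?_
    have h2 : Nj * ((M.cov j)⁻¹ c c + Nj / M.noiseVar j c) ≤
        ((M.cov j)⁻¹ c c + 1 / M.noiseVar j c) * Nj ^ 2 := by
      have := mul_le_mul_of_nonneg_left hNj1 (h.precision_diag_pos j c).le
      have h3 : Nj * (Nj / M.noiseVar j c) = 1 / M.noiseVar j c * Nj ^ 2 := by ring
      rw [mul_add, h3, add_mul]
      linarith
    exact h2.trans (mul_le_mul_of_nonneg_right (hUle j c) (sq_nonneg _))
  have h4 : Nk ^ 2 ≤ G * Nj ^ 2 := by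
    calc Nk ^ 2 ≤ M.noiseVar k c * ratio M x n k c := h.count_sq_le n k c
      _ ≤ V * (Fintype.card K * (U * Nj ^ 2)) := by
          refine mul_le_mul (hVle k c) (hr.trans ?_) (h.ratio_nonneg n k c) hV0
          exact mul_le_mul_of_nonneg_left h1 (Nat.cast_nonneg _)
      _ = _ := by rw [hG]; ring
  refine abs_le_of_sq_le_sq' ?_ (by positivity) |>.2
  nlinarith [sq_nonneg Nj, mul_nonneg hG0 (sq_nonneg Nj),
    mul_nonneg (mul_nonneg hG0 hG0) (sq_nonneg Nj)]

/-- No pair sampled infinitely often outgrows all others at its context. -/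
lemma exists_comparable [Nontrivial K] (h : IsRegularPath M F e N₀ x y b) {a : K × C}
    (ha : ¬ SampledInfOften x a) {k : K} {c : C} (hk : SampledInfOften x (k, c)) :
    ∃ Γ : ℝ, 0 < Γ ∧ ∀ᶠ n in atTop, ∃ j, j ≠ k ∧ SampledInfOften x (j, c) ∧
      sampleCount x n (k, c) ≤ Γ * sampleCount x n (j, c) := by
  obtain ⟨Γ, hΓ0, hΓ⟩ := h.count_le_of_ratio_le
  obtain ⟨Z, -, hZ⟩ := h.late_step ha
  have hm : (1 : ℝ) ≤ Fintype.card K := by exact_mod_cast Fintype.card_pos (α := K)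
  have hsmall : ∀ᶠ n in atTop, ∀ j, ¬ SampledInfOften x (j, c) →
      Fintype.card K * ratio M x n j c < ratio M x n k c := by
    refine eventually_all.2 fun j => ?_
    by_cases hj : SampledInfOften x (j, c)
    · exact Eventually.of_forall fun n hj' => absurd hj hj'
    · obtain ⟨R, hR⟩ := h.ratio_bounded hj
      filter_upwards [(h.tendsto_ratio hk).eventually_gt_atTop (Fintype.card K * R)] with n hn _
      exact (mul_le_mul_of_nonneg_left (hR n) (by positivity)).trans_lt hn
  have hsample : ∀ᶠ n in atTop, x n = (k, c) → ∃ j, j ≠ k ∧ SampledInfOften x (j, c) ∧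
      ratio M x n k c ≤ Fintype.card K * ratio M x n j c := by
    filter_upwards [hZ, hsmall] with n hn hsmall hx
    obtain ⟨k', c', hx', -, hb, -, ⟨hkb, hr⟩ | ⟨hkb, hr, -⟩⟩ := hn
    · rw [hx, Prod.mk.injEq] at hx'
      obtain ⟨rfl, rfl⟩ := hx'
      -- Pigeonhole: a ratio below the sum of the others is at most `Fintype.card K` times one of
      -- them.
      have : ∃ j, j ≠ k ∧ ratio M x n k c ≤ Fintype.card K * ratio M x n j c := by
        by_contra hcon
        push Not at hcon
        have h1 : Fintype.card K * ∑ j ∈ Finset.univ.filter (· ≠ k), ratio M x n j c ≤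
            Fintype.card K * ratio M x n k c := by
          rw [Finset.mul_sum]
          calc _ ≤ ∑ j ∈ Finset.univ.filter (· ≠ k), ratio M x n k c :=
                Finset.sum_le_sum fun j hj => (hcon j (Finset.mem_filter.1 hj).2).le
            _ = (Finset.univ.filter (· ≠ k)).card * ratio M x n k c := by simp
            _ ≤ _ := by
                refine mul_le_mul_of_nonneg_right ?_ (h.ratio_nonneg n k c)
                exact_mod_cast Finset.card_le_univ _
        have h2 := le_of_mul_le_mul_left h1 (by linarith)
        linarith
      obtain ⟨j, hj, hjr⟩ := this
      refine ⟨j, hj, ?_, hjr⟩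
      by_contra hjI
      exact absurd hjr (not_le.2 (hsmall j hjI))
    · rw [hx, Prod.mk.injEq] at hx'
      obtain ⟨rfl, rfl⟩ := hx'
      refine ⟨b n c, hkb.symm, hb, hr.trans ?_⟩
      exact le_mul_of_one_le_left (h.ratio_nonneg n _ c) hm
  have hpos : ∀ᶠ n in atTop, 0 < sampleCount x n (k, c) := hk.eventually_gt_atTop 0
  obtain ⟨T, hT⟩ := eventually_atTop.1 (hsample.and hpos)
  obtain ⟨T₁, hT₁, hxT₁⟩ := frequently_atTop.1 hk.frequently T
  have hstep : ∀ n, T ≤ n → x n = (k, c) → ∃ j, j ≠ k ∧ SampledInfOften x (j, c) ∧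
      (sampleCount x (n + 1) (k, c) : ℝ) ≤ (Γ + 1) * sampleCount x (n + 1) (j, c) := by
    intro n hn hx
    obtain ⟨j, hj, hjI, hr⟩ := (hT n hn).1 hx
    refine ⟨j, hj, hjI, ?_⟩
    have h1 := hΓ n k j c hr
    have h2 : (0 : ℝ) < sampleCount x n (k, c) := by exact_mod_cast (hT n hn).2
    have h3 : (0 : ℝ) < sampleCount x n (j, c) := by
      by_contra h0
      have : Γ * (sampleCount x n (j, c) : ℝ) ≤ 0 :=
        mul_nonpos_of_nonneg_of_nonpos hΓ0.le (not_lt.1 h0)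
      linarith
    have h4 : (1 : ℝ) ≤ sampleCount x n (j, c) := by exact_mod_cast h3
    have h5 : sampleCount x (n + 1) (j, c) = sampleCount x n (j, c) := by
      rw [sampleCount_succ, hx, if_neg (by simpa using hj.symm), add_zero]
    rw [h5, sampleCount_succ, if_pos hx]
    push_cast
    linarith
  -- The extra `1` pays for the sample just taken. Until the next sample of `(k, c)`, its count is
  -- constant and the rival's can only grow.
  refine ⟨Γ + 1, by positivity, eventually_atTop.2 ⟨T₁ + 1, fun n hn => ?_⟩⟩
  induction n, hn using Nat.le_induction with
  | base => exact hstep T₁ hT₁ hxT₁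
  | succ n hn ih =>
    by_cases hx : x n = (k, c)
    · exact hstep n (by omega) hx
    · obtain ⟨j, hj, hjI, hle⟩ := ih
      refine ⟨j, hj, hjI, ?_⟩
      rw [sampleCount_succ, if_neg hx, add_zero]
      refine hle.trans (mul_le_mul_of_nonneg_left ?_ (by positivity))
      exact_mod_cast sampleCount_mono x (j, c) (Nat.le_succ n)

lemma sampledInfOften [Nontrivial K] (h : IsRegularPath M F e N₀ x y b) (a : K × C) :
    SampledInfOften x a := by
  by_contra ha
  obtain ⟨Z, hZ0, hZ⟩ := h.late_step ha
  obtain ⟨n₀, hn₀⟩ := hZ.exists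
  obtain ⟨k, c, -, hk, -⟩ := hn₀
  obtain ⟨Γ₁, hΓ₁0, hΓ₁⟩ := h.exists_comparable ha hk
  obtain ⟨Γ₂, hΓ₂0, hΓ₂⟩ := h.count_le_of_ratio_le
  obtain ⟨B, hB0, hB⟩ := h.mean_error
  set Γ := Γ₁ + Γ₂ with hΓ
  have hΓ0 : 0 < Γ := by positivity
  set V := ∑ k, (M.noiseVar k c : ℝ) with hV
  have hVle : ∀ k, (M.noiseVar k c : ℝ) ≤ V := fun k =>
    Finset.single_le_sum (f := fun k => (M.noiseVar k c : ℝ)) (fun c _ => NNReal.coe_nonneg _)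
      (Finset.mem_univ k)
  have hV0 : 0 ≤ V := Finset.sum_nonneg fun k _ => NNReal.coe_nonneg _
  -- Chosen with `q ≥ 1`, so that `q² ≥ q > Z V (Γ + 1)`; a mean gap above `q / √L` then forces ζ
  -- above `Z`.
  set q := Z * (V * (Γ + 1)) + 1 with hq
  have hq1 : 1 ≤ q := by
    have : 0 ≤ Z * (V * (Γ + 1)) := by positivity
    linarith
  -- The excursion must beat the required gap `q`, the error `B` at `k`, and the possible deficit `Γ
  -- + 1 + B Γ` of the rival `j`, all in units of `1 / √L`.
  obtain ⟨Q, hQ⟩ := exists_nat_gt (q + (B + Γ + 1 + B * Γ))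
  obtain ⟨T, hT⟩ := eventually_atTop.1 (hZ.and (hΓ₁.and hB))
  obtain ⟨L, ⟨hLk, hLj⟩, hLT, hL0⟩ := ((h.excursion (k, c) Q).and_eventually
    ((eventually_ge_atTop (sampleCount x T (k, c))).and (eventually_gt_atTop 0))).exists
  obtain ⟨n₁, hn₁, hcount⟩ := hk.exists_eq hLT
  obtain ⟨j, hjk, hjI, hj⟩ := (hT n₁ hn₁).2.1
  have hLR : (1 : ℝ) ≤ L := by exact_mod_cast hL0
  set l := √(L : ℝ) with hl
  have hl1 : 1 ≤ l := Real.one_le_sqrt.2 hLR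
  have hll : l * l = L := Real.mul_self_sqrt (by linarith)
  have hl0 : 0 < l := by linarith
  -- While the count of `(k, c)` is `L`, its mean remains low. The rival stays good because its
  -- count only grows and the excursion condition controls its noise at every count, so the
  -- obstruction to sampling `(k, c)` persists.
  have hfreeze : ∀ n, n₁ ≤ n → sampleCount x n (k, c) = L := by
    intro n hn
    induction n, hn using Nat.le_induction with
    | base => exact hcount
    | succ n hn ih =>
      rw [sampleCount_succ, ih]
      suffices x n ≠ (k, c) by simp [this]
      intro hx
      obtain ⟨hstep, -, herr⟩ := hT n (hn₁.trans hn)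
      have hmk : M.postMean x y n k c - F k c ≤ -(Q - B) / l := by
        have h1 := (abs_le.1 (herr k c).2).2
        rw [ih] at h1
        rw [le_div_iff₀ hl0]
        have h2 : l * ((M.postMean x y n k c - F k c) * l) ≤ l * (-(Q - B)) := by
          have : B ≤ l * B := le_mul_of_one_le_left hB0 hl1
          rw [← hll] at h1
          linarith
        exact le_of_mul_le_mul_left h2 hl0
      have hNj : (L : ℝ) ≤ Γ * sampleCount x n (j, c) := by
        rw [hcount] at hj
        refine hj.trans (mul_le_mul ?_ ?_ (Nat.cast_nonneg _) hΓ0.le)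
        · linarith
        · exact_mod_cast sampleCount_mono x (j, c) hn
      have hmj : -(Γ + 1 + B * Γ) / l ≤ M.postMean x y n j c - F k c := by
        rw [h.reward_eq ha hk hjI]
        have h1 := (abs_le.1 (herr j c).2).1
        have h2 := hLj (j, c) (by simpa using hjk) (sampleCount x n (j, c))
        set N : ℝ := ((sampleCount x n (j, c) : ℕ) : ℝ) with hN
        have hNpos : 0 < N := by
          by_contra h0
          have : Γ * N ≤ 0 := mul_nonpos_of_nonneg_of_nonpos hΓ0.le (not_lt.1 h0)
          linarith
        rw [div_le_iff₀ hl0]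
        have h3 : l ≤ Γ * N / l := by rw [le_div_iff₀ hl0, hll]; exact hNj
        have h4 : 1 ≤ Γ * N / l := hl1.trans h3
        have h5 : B ≤ B * (Γ * N / l) := le_mul_of_one_le_right hB0 h4
        have h6 : N * (-(Γ + 1 + B * Γ)) ≤ N * ((M.postMean x y n j c - F j c) * l) := by
          have h7 : (-(l + N / l) - B) * l ≤ N * (M.postMean x y n j c - F j c) * l :=
            mul_le_mul_of_nonneg_right (by linarith) hl0.le
          have h8 : (Γ * N / l + N / l + B * (Γ * N / l)) * l = N * (Γ + 1 + B * Γ) := by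
            field_simp
          have h9 : (l + N / l + B) * l ≤ (Γ * N / l + N / l + B * (Γ * N / l)) * l :=
            mul_le_mul_of_nonneg_right (by linarith) hl0.le
          linarith
        exact le_of_mul_le_mul_left h6 hNpos
      have hgap : q / l < M.postMean x y n j c - M.postMean x y n k c := by
        have h1 : q / l < (-(Γ + 1 + B * Γ)) / l - (-(Q - B) / l) := by
          rw [← sub_div, div_lt_div_iff_of_pos_right hl0]
          linarith
        linarith
      have hgap' : q / l < M.postMean x y n (b n c) c - M.postMean x y n k c :=
        hgap.trans_le (sub_le_sub_right (h.predictedBest n c j) _)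
      have hql : 0 < q / l := by positivity
      obtain ⟨k', c', hx', -, -, -, ⟨hkb, -⟩ | ⟨-, hr, hz⟩⟩ := hstep
      · rw [hx, Prod.mk.injEq] at hx'
        obtain ⟨rfl, rfl⟩ := hx'
        rw [← hkb] at hgap'
        linarith
      · rw [hx, Prod.mk.injEq] at hx'
        obtain ⟨rfl, rfl⟩ := hx'
        have hNb : (L : ℝ) ≤ Γ * sampleCount x n (b n c, c) := by
          have h1 := hΓ₂ n k (b n c) c (hr.trans (le_mul_of_one_le_left (h.ratio_nonneg n _ c)
            (by exact_mod_cast Fintype.card_pos (α := K))))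
          rw [ih] at h1
          refine h1.trans (mul_le_mul_of_nonneg_right (by linarith) (Nat.cast_nonneg _))
        have hsk : L * M.postVar x n k c ≤ V := by
          have := h.count_mul_postVar_le n k c
          rw [ih] at this
          exact this.trans (hVle k)
        have hsb : L * M.postVar x n (b n c) c ≤ Γ * V := by
          calc L * M.postVar x n (b n c) c
              ≤ Γ * sampleCount x n (b n c, c) * M.postVar x n (b n c) c :=
                mul_le_mul_of_nonneg_right hNb (h.postVar_pos n _ c).le
            _ = Γ * (sampleCount x n (b n c, c) * M.postVar x n (b n c) c) := by ring
            _ ≤ Γ * V := mul_le_mul_of_nonneg_left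
                ((h.count_mul_postVar_le n _ c).trans (hVle _)) hΓ0.le
        have h1 : (q / l) ^ 2 < Z * (M.postVar x n (b n c) c + M.postVar x n k c) :=
          lt_of_lt_of_le (by gcongr) hz
        have h2 : L * (q / l) ^ 2 = q ^ 2 := by
          rw [← hll]; field_simp
        have h3 : L * (q / l) ^ 2 < L * (Z * (M.postVar x n (b n c) c + M.postVar x n k c)) :=
          mul_lt_mul_of_pos_left h1 (by linarith)
        have h4 : L * (Z * (M.postVar x n (b n c) c + M.postVar x n k c)) ≤
            Z * (V * (Γ + 1)) := by
          have : L * (Z * (M.postVar x n (b n c) c + M.postVar x n k c)) =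
            Z * (L * M.postVar x n (b n c) c + L * M.postVar x n k c) := by ring
          rw [this]
          exact mul_le_mul_of_nonneg_left (by linarith) hZ0
        nlinarith
  obtain ⟨n, hn, hn'⟩ := ((hk.eventually_gt_atTop L).and (eventually_ge_atTop n₁)).exists
  rw [hfreeze n hn'] at hn
  exact lt_irrefl _ hn

lemma eventually_best_eq [Nontrivial K] (h : IsRegularPath M F e N₀ x y b) {πstar : C → K}
    (hbest : ∀ c k, k ≠ πstar c → F k c < F (πstar c) c) (c : C) :
    ∀ᶠ n in atTop, b n c = πstar c := by
  have h1 : ∀ k, ∀ᶠ n in atTop, k ≠ πstar c →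
      M.postMean x y n k c < M.postMean x y n (πstar c) c := fun k => by
    by_cases hk : k = πstar c
    · exact Eventually.of_forall fun n hn => absurd hk hn
    · filter_upwards [(h.tendsto_mean (h.sampledInfOften (k, c))).eventually_lt
        (h.tendsto_mean (h.sampledInfOften (πstar c, c))) (hbest c k hk)] with n hn _
      exact hn
  filter_upwards [eventually_all.2 h1] with n hn
  by_contra hne
  exact absurd (h.predictedBest n c (πstar c)) (not_le.2 (hn _ hne))

end IsRegularPath

/-! ### Independence of blocks and estimates for Gaussian random walks. -/

section Probability

/-- Events that depend on pairwise disjoint blocks of an independent family are independent. -/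
lemma iIndepSet_of_disjoint_blocks {Ω ι J : Type*} {mΩ : MeasurableSpace Ω} {P : Measure Ω}
    [IsProbabilityMeasure P] {m : ι → MeasurableSpace Ω} (hle : ∀ i, m i ≤ mΩ) (hm : iIndep m P)
    {S : J → Set ι} (hS : Pairwise fun i j => Disjoint (S i) (S j)) {V : J → Set Ω}
    (hV : ∀ j, MeasurableSet[⨆ i ∈ S j, m i] (V j)) : iIndepSet V P := by
  classical
  have hVm : ∀ j, MeasurableSet (V j) := fun j => iSup₂_le (fun i _ => hle i) _ (hV j)
  rw [iIndepSet_iff_meas_biInter hVm]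
  intro s
  induction s using Finset.induction_on with
  | empty => simp
  | insert j s hj ih =>
    rw [Finset.set_biInter_insert, Finset.prod_insert hj, ← ih]
    have hdisj : Disjoint (S j) (⋃ j' ∈ s, S j') := by
      simp only [Set.disjoint_iUnion_right]
      intro j' hj'
      exact hS fun h => hj (h ▸ hj')
    refine (Indep_iff _ _ _).1 (indep_iSup_of_disjoint hle hm hdisj) _ _ (hV j) ?_
    refine Finset.measurableSet_biInter _ fun j' hj' => ?_
    have hsub : (⨆ i ∈ S j', m i) ≤ ⨆ i ∈ ⋃ j' ∈ s, S j', m i :=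
      biSup_mono fun i hi => Set.mem_biUnion (s := (s : Set J)) hj' hi
    exact hsub _ (hV j')

variable {Ω : Type*} {mΩ : MeasurableSpace Ω} {P : Measure Ω} [IsProbabilityMeasure P]

/-- The exponential martingale inequality for a Gaussian random walk. -/
lemma measure_exists_ge_le_exp {X : ℕ → Ω → ℝ} {v : ℝ≥0} (hX : ∀ j, Measurable (X j))
    (hlaw : ∀ j, P.map (X j) = gaussianReal 0 v) (hind : iIndepFun X P) (t s : ℝ) (n : ℕ) :
    P {ω | ∃ r ≤ n, s ≤ t * ∑ j ∈ Finset.range r, X j ω - r * (v * t ^ 2 / 2)} ≤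
      ENNReal.ofReal (Real.exp (-s)) := by
  set m : ℕ → MeasurableSpace Ω := fun j => MeasurableSpace.comap (X j) inferInstance with hm
  have hmle : ∀ j, m j ≤ mΩ := fun j => (hX j).comap_le
  -- `𝒢 r` involves only indices strictly below `r`, so the factor `Z r` is independent of it.
  let 𝒢 : Filtration ℕ mΩ :=
    { seq := fun r => ⨆ j ∈ Set.Iio r, m j
      mono' := fun a b hab => biSup_mono fun j hj => lt_of_lt_of_le hj hab
      le' := fun r => iSup₂_le fun j _ => hmle j }
  set f : ℕ → Ω → ℝ := fun r ω =>
    Real.exp (t * ∑ j ∈ Finset.range r, X j ω - r * (v * t ^ 2 / 2)) with hf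
  set Z : ℕ → Ω → ℝ := fun r ω => Real.exp (t * X r ω - v * t ^ 2 / 2) with hZ
  have hsucc : ∀ r, f (r + 1) = f r * Z r := by
    intro r
    funext ω
    simp only [hf, hZ, Pi.mul_apply, ← Real.exp_add, Finset.sum_range_succ]
    congr 1
    push_cast
    ring
  have hXm : ∀ r j, j < r → Measurable[𝒢 r] (X j) := fun r j hj =>
    (comap_measurable (X j)).mono (le_iSup₂_of_le (f := fun j (_ : j ∈ Set.Iio r) => m j)
      j hj le_rfl) le_rfl
  have hfm : ∀ r, Measurable[𝒢 r] (f r) := fun r => by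
    refine Real.measurable_exp.comp (Measurable.sub_const (Measurable.const_mul ?_ _) _)
    exact Finset.measurable_fun_sum _ fun j hj => hXm r j (Finset.mem_range.1 hj)
  have hZm : ∀ r, Measurable[m r] (Z r) := fun r =>
    Real.measurable_exp.comp (((comap_measurable (X r)).const_mul _).sub_const _)
  have hindep : ∀ r, Indep (m r) (𝒢 r) P := fun r => by
    have h1 : Disjoint ({r} : Set ℕ) (Set.Iio r) := by simp
    have h2 := indep_iSup_of_disjoint hmle hind.iIndep h1
    rw [iSup_singleton] at h2
    exact h2
  have hexp : ∀ r, Integrable (fun ω => Real.exp (t * X r ω)) P := fun r => by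
    have h1 := integrable_exp_mul_gaussianReal (μ := 0) (v := v) t
    rw [← hlaw r] at h1
    exact h1.comp_measurable (hX r)
  have hZe : ∀ r, Z r = fun ω => Real.exp (t * X r ω) * Real.exp (-(v * t ^ 2 / 2)) := fun r => by
    funext ω
    rw [← Real.exp_add, ← sub_eq_add_neg]
  have hZi : ∀ r, Integrable (Z r) P := fun r => by
    rw [hZe]; exact (hexp r).mul_const _
  have hZint : ∀ r, ∫ ω, Z r ω ∂P = 1 := fun r => by
    have h1 := mgf_gaussianReal (hlaw r) t
    rw [mgf] at h1
    rw [hZe, integral_mul_const, h1, ← Real.exp_add]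
    simp
  have hfZ : ∀ r, IndepFun (f r) (Z r) P := fun r =>
    (IndepFun_iff_Indep _ _ _).2 (indep_of_indep_of_le_left
      (indep_of_indep_of_le_right (hindep r).symm (hZm r).comap_le) (hfm r).comap_le)
  have hfmΩ : ∀ r, Measurable (f r) := fun r => (hfm r).mono (𝒢.le r) le_rfl
  have hfi : ∀ r, Integrable (f r) P ∧ ∫ ω, f r ω ∂P = 1 := by
    intro r
    induction r with
    | zero => simp [hf]
    | succ r ih =>
      rw [hsucc]
      refine ⟨(hfZ r).integrable_mul ih.1 (hZi r), ?_⟩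
      rw [(hfZ r).integral_mul_eq_mul_integral (hfmΩ r).aestronglyMeasurable
        (hZi r).aestronglyMeasurable, ih.2, hZint, one_mul]
  have hmart : Martingale f 𝒢 P := by
    refine martingale_nat (fun r => (hfm r).stronglyMeasurable) (fun r => (hfi r).1) fun r => ?_
    have h1 := condExp_mul_of_stronglyMeasurable_left (μ := P) (m := 𝒢 r) (f := f r) (g := Z r)
      (hfm r).stronglyMeasurable (hsucc r ▸ (hfi (r + 1)).1) (hZi r)
    have h2 := condExp_indep_eq (hmle r) (𝒢.le r) (hZm r).stronglyMeasurable (hindep r)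
    rw [hsucc]
    filter_upwards [h1, h2] with ω h1 h2
    rw [h1, Pi.mul_apply, h2, hZint, mul_one]
  have hmax := maximal_ineq hmart.submartingale (fun r ω => (Real.exp_pos _).le)
    (ε := (Real.exp s).toNNReal) n
  set A := {ω | ((Real.exp s).toNNReal : ℝ) ≤
    (Finset.range (n + 1)).sup' Finset.nonempty_range_add_one fun k => f k ω} with hA
  have hsub : {ω | ∃ r ≤ n, s ≤ t * ∑ j ∈ Finset.range r, X j ω - r * (v * t ^ 2 / 2)} ⊆ A := by
    rintro ω ⟨r, hr, hs⟩
    refine le_trans ?_ (Finset.le_sup' (fun k => f k ω)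
      (Finset.mem_range.2 (Nat.lt_succ_of_le hr)))
    rw [Real.coe_toNNReal _ (Real.exp_pos s).le]
    exact Real.exp_le_exp.2 hs
  have hint : ∫ ω in A, f n ω ∂P ≤ 1 := by
    rw [← (hfi n).2]
    exact setIntegral_le_integral (hfi n).1 (Eventually.of_forall fun ω => (Real.exp_pos _).le)
  have h1 : ENNReal.ofReal (Real.exp s) * P A ≤ 1 := by
    refine hmax.trans ?_
    rw [← ENNReal.ofReal_one]
    exact ENNReal.ofReal_le_ofReal hint
  calc _ ≤ P A := measure_mono hsub
    _ = ENNReal.ofReal (Real.exp (-s)) * (ENNReal.ofReal (Real.exp s) * P A) := by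
        rw [← mul_assoc, ← ENNReal.ofReal_mul (Real.exp_pos _).le, ← Real.exp_add]
        simp
    _ ≤ ENNReal.ofReal (Real.exp (-s)) * 1 := by gcongr
    _ = _ := mul_one _

lemma map_sum_gaussianReal {X : ℕ → Ω → ℝ} {v : ℝ≥0} (hX : ∀ j, Measurable (X j))
    (hlaw : ∀ j, P.map (X j) = gaussianReal 0 v) (hind : iIndepFun X P) (n : ℕ) :
    P.map (∑ j ∈ Finset.range n, X j) = gaussianReal 0 (n * v) := by
  induction n with
  | zero =>
    simp only [Finset.range_zero, Finset.sum_empty, Nat.cast_zero, zero_mul, gaussianReal_zero_var]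
    change P.map (fun _ => (0 : ℝ)) = _
    rw [Measure.map_const]; simp
  | succ n ih =>
    rw [Finset.sum_range_succ, gaussianReal_add_gaussianReal_of_indepFun
      (hind.indepFun_sum_range_succ hX n) ih (hlaw n)]
    push_cast
    rw [add_zero, add_mul, one_mul]

/-- A Gaussian random walk is below `q √n` at time `n` with probability bounded below. -/
lemma exists_pos_le_measure_sum_le {v : ℝ≥0} (hv : 0 < v) (q : ℝ) :
    ∃ p : ENNReal, 0 < p ∧ ∀ X : ℕ → Ω → ℝ, (∀ j, Measurable (X j)) →
      (∀ j, P.map (X j) = gaussianReal 0 v) → iIndepFun X P → ∀ n : ℕ, 0 < n → ∀ z : ℝ,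
      q * √n ≤ z → p ≤ P {ω | ∑ j ∈ Finset.range n, X j ω ≤ z} := by
  -- By Gaussian scaling, the sum divided by `√n` has law `gaussianReal 0 v`, so one `p` serves all
  -- lengths.
  refine ⟨gaussianReal 0 v (Set.Iic q), ?_, ?_⟩
  · rw [pos_iff_ne_zero]
    intro h0
    have := gaussianReal_absolutelyContinuous' 0 hv.ne' h0
    simp at this
  · intro X hX hlaw hind n hn z hz
    have hnR : (0 : ℝ) < n := by exact_mod_cast hn
    have h1 : gaussianReal 0 ((n : ℝ≥0) * v) =
        (gaussianReal 0 v).map (fun x => √(n : ℝ) * x) := by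
      rw [gaussianReal_map_const_mul, mul_zero]
      congr 2
      ext
      simp [Real.sq_sqrt hnR.le]
    have h2 : {ω | ∑ j ∈ Finset.range n, X j ω ≤ z} =
        (∑ j ∈ Finset.range n, X j) ⁻¹' Set.Iic z := by
      ext ω; simp
    rw [h2, ← Measure.map_apply (by fun_prop) measurableSet_Iic,
      map_sum_gaussianReal hX hlaw hind, h1, Measure.map_apply (by fun_prop) measurableSet_Iic]
    refine measure_mono fun x hx => ?_
    have hx' : x ≤ q := hx
    change √(n : ℝ) * x ≤ z
    have := mul_le_mul_of_nonneg_left hx' (Real.sqrt_nonneg (n : ℝ))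
    linarith

lemma summable_exp_neg_mul_sqrt {c : ℝ} (hc : 0 < c) :
    Summable fun n : ℕ => Real.exp (-(c * √n)) := by
  have h1 : Summable fun n : ℕ => 24 / c ^ 4 * (1 / (n : ℝ) ^ 2) :=
    (Real.summable_one_div_nat_pow.2 one_lt_two).mul_left _
  refine Summable.of_norm_bounded_eventually_nat h1 ?_
  filter_upwards [eventually_gt_atTop 0] with n hn
  have hnR : (0 : ℝ) < n := by exact_mod_cast hn
  have hx : 0 < c * √(n : ℝ) := by positivity
  have h2 := Real.pow_div_factorial_le_exp _ hx.le 4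
  rw [Real.norm_eq_abs, abs_of_pos (Real.exp_pos _), Real.exp_neg,
    inv_le_comm₀ (Real.exp_pos _) (by positivity)]
  refine le_trans (le_of_eq ?_) h2
  have h3 : √(n : ℝ) ^ 4 = (n : ℝ) ^ 2 := by
    rw [show (4 : ℕ) = 2 * 2 from rfl, pow_mul, Real.sq_sqrt hnR.le]
  rw [mul_pow, h3]
  simp [Nat.factorial]
  field_simp

/-- The sub-Gaussian tail at level `n^(3/4)` is `exp(-√n / (2 v))`, which is summable; the first
Borel–Cantelli lemma applies. -/
lemma ae_eventually_sum_lt {X : ℕ → Ω → ℝ} {v : ℝ≥0} (hv : 0 < v) (hX : ∀ j, Measurable (X j))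
    (hlaw : ∀ j, P.map (X j) = gaussianReal 0 v) (hind : iIndepFun X P) :
    ∀ᵐ ω ∂P, ∀ᶠ n : ℕ in atTop, ∑ j ∈ Finset.range n, X j ω < √(n * √n) := by
  have hsub : ∀ j, HasSubgaussianMGF (X j) v P := fun j =>
    { integrable_exp_mul := fun t => by
        have h1 := integrable_exp_mul_gaussianReal (μ := 0) (v := v) t
        rw [← hlaw j] at h1
        exact h1.comp_measurable (hX j)
      mgf_le := fun t => by rw [mgf_gaussianReal (hlaw j)]; simp }
  have hvR : (0 : ℝ) < v := by exact_mod_cast hv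
  have hsum := summable_exp_neg_mul_sqrt (c := 1 / (2 * v)) (by positivity)
  have hbound : ∀ n : ℕ, P {ω | √(n * √n) ≤ ∑ j ∈ Finset.range n, X j ω} ≤
      ENNReal.ofReal (Real.exp (-(1 / (2 * v) * √n))) := by
    intro n
    have h1 := HasSubgaussianMGF.measure_sum_range_ge_le_of_iIndepFun hind (n := n)
      (fun j _ => hsub j) (Real.sqrt_nonneg (n * √n))
    rw [← ENNReal.ofReal_toReal (measure_ne_top P _)]
    refine ENNReal.ofReal_le_ofReal (h1.trans (le_of_eq ?_))
    rw [Real.sq_sqrt (by positivity)]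
    congr 1
    rcases Nat.eq_zero_or_pos n with rfl | hn
    · simp
    · have hnR : (0 : ℝ) < n := by exact_mod_cast hn
      field_simp
  have hfin : ∑' n : ℕ, P {ω | √(n * √n) ≤ ∑ j ∈ Finset.range n, X j ω} ≠ ⊤ :=
    ne_top_of_le_ne_top (hsum.tsum_ofReal_ne_top) (ENNReal.tsum_le_tsum hbound)
  filter_upwards [ae_eventually_notMem hfin] with ω hω
  filter_upwards [hω] with n hn
  exact not_le.1 hn

lemma ae_eventually_sum_sq_le {X : ℕ → Ω → ℝ} {v : ℝ≥0} (hv : 0 < v) (hX : ∀ j, Measurable (X j))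
    (hlaw : ∀ j, P.map (X j) = gaussianReal 0 v) (hind : iIndepFun X P) :
    ∀ᵐ ω ∂P, ∀ᶠ n : ℕ in atTop, (∑ j ∈ Finset.range n, X j ω) ^ 2 ≤ n * √n := by
  have hneg : ∀ j, P.map (fun ω => -X j ω) = gaussianReal 0 v := fun j => by
    have h1 := gaussianReal_map_neg (μ := 0) (v := v)
    rw [← hlaw j, Measure.map_map measurable_neg (hX j), neg_zero] at h1
    exact h1
  have hind' : iIndepFun (fun j ω => -X j ω) P :=
    hind.comp (fun _ x => -x) fun _ => measurable_neg
  filter_upwards [ae_eventually_sum_lt hv hX hlaw hind,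
    ae_eventually_sum_lt hv (fun j => (hX j).neg) hneg hind'] with ω h1 h2
  filter_upwards [h1, h2] with n h1 h2
  simp only [Pi.neg_apply, Finset.sum_neg_distrib] at h2
  have h3 : |∑ j ∈ Finset.range n, X j ω| ≤ √(n * √n) := abs_le.2 ⟨by linarith, h1.le⟩
  rw [← sq_abs]
  refine (pow_le_pow_left₀ (abs_nonneg _) h3 2).trans ?_
  rw [Real.sq_sqrt (by positivity)]

end Probability

/-! ### Almost sure occurrence of simultaneous noise excursions. -/

section Excursions

/-- The start of the `i`-th block of noise variables. -/
def blockStart (i : ℕ) : ℕ := 2 ^ 8 ^ i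

lemma blockStart_succ (i : ℕ) : blockStart (i + 1) = blockStart i ^ 8 := by
  rw [blockStart, blockStart, pow_succ, pow_mul]

lemma two_le_blockStart (i : ℕ) : 2 ≤ blockStart i :=
  Nat.le_self_pow (pow_ne_zero _ (by norm_num)) 2

lemma blockStart_strictMono : StrictMono blockStart := fun _ _ h =>
  Nat.pow_lt_pow_right (by norm_num) (Nat.pow_lt_pow_right (by norm_num) h)

variable {K C Ω : Type*}

lemma noiseSum_add (e : ℕ → K → C → ℝ) (a : K × C) (l r : ℕ) :
    noiseSum e a (l + r) = noiseSum e a l + ∑ j ∈ Finset.range r, e (l + j) a.1 a.2 :=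
  Finset.sum_range_add _ _ _

lemma tendsto_noiseSum_div {e : ℕ → K → C → ℝ} {a : K × C}
    (h : ∀ᶠ n : ℕ in atTop, noiseSum e a n ^ 2 ≤ n * √n) :
    Tendsto (fun n : ℕ => noiseSum e a n / n) atTop (nhds 0) := by
  have hs : Tendsto (fun n : ℕ => √(n : ℝ)) atTop atTop :=
    Real.tendsto_sqrt_atTop.comp tendsto_natCast_atTop_atTop
  have h1 : Tendsto (fun n : ℕ => (noiseSum e a n / n) ^ 2) atTop (nhds 0) := by
    refine squeeze_zero' (Eventually.of_forall fun n => sq_nonneg _) ?_ (hs.const_div_atTop 1)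
    filter_upwards [h, eventually_gt_atTop 0] with n hn hn0
    have hnR : (0 : ℝ) < n := by exact_mod_cast hn0
    rw [div_pow, div_le_div_iff₀ (by positivity) (by positivity)]
    have h2 : √(n : ℝ) * √n = n := Real.mul_self_sqrt hnR.le
    calc noiseSum e a n ^ 2 * √n ≤ n * √n * √n := by gcongr
      _ = 1 * n ^ 2 := by rw [mul_assoc, h2]; ring
  have h3 := h1.sqrt
  simp only [Real.sqrt_sq_eq_abs, Real.sqrt_zero] at h3
  exact (tendsto_zero_iff_abs_tendsto_zero _).2 h3

/-- The indices of the noise variables at `p` in the `i`-th block. -/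
def blockIdx (ip : ℕ × K × C) : Set (ℕ × K × C) :=
  {i | blockStart ip.1 ≤ i.1 ∧ i.1 < blockStart (ip.1 + 1) ∧ i.2 = ip.2}

lemma disjoint_blockIdx : Pairwise fun i j : ℕ × K × C => Disjoint (blockIdx i) (blockIdx j) := by
  intro i j hij
  rw [Set.disjoint_left]
  rintro n ⟨h1, h2, h3⟩ ⟨h4, h5, h6⟩
  refine hij (Prod.ext ?_ (h3.symm.trans h6))
  have h7 := blockStart_strictMono.lt_iff_lt.1 (h1.trans_lt h5)
  have h8 := blockStart_strictMono.lt_iff_lt.1 (h4.trans_lt h2)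
  omega

variable [DecidableEq K] [DecidableEq C]

/-- In the `i`-th block, the noise at `a` makes a deep downward excursion (if `p = a`), respectively
the noise at `p` stays moderate (if `p ≠ a`). -/
def excursionEvent (ε : ℕ → K → C → Ω → ℝ) (a : K × C) (Q : ℕ) (ip : ℕ × K × C) : Set Ω :=
  if ip.2 = a then
    {ω | ∑ j ∈ Finset.range (blockStart ip.1 ^ 2 - blockStart ip.1),
      ε (blockStart ip.1 + j) ip.2.1 ip.2.2 ω ≤ -(Q + 1) * blockStart ip.1}
  else
    {ω | ∀ r ≤ blockStart (ip.1 + 1) - blockStart ip.1,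
      -((blockStart ip.1 : ℝ) / 2 + r / (2 * blockStart ip.1)) ≤
        ∑ j ∈ Finset.range r, ε (blockStart ip.1 + j) ip.2.1 ip.2.2 ω}

lemma measurableSet_excursionEvent (ε : ℕ → K → C → Ω → ℝ) (a : K × C) (Q : ℕ)
    (ip : ℕ × K × C) :
    MeasurableSet[⨆ i ∈ blockIdx ip, MeasurableSpace.comap (ε i.1 i.2.1 i.2.2) inferInstance]
      (excursionEvent ε a Q ip) := by
  set m : MeasurableSpace Ω :=
    ⨆ i ∈ blockIdx ip, MeasurableSpace.comap (ε i.1 i.2.1 i.2.2) inferInstance with hm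
  have hsum : ∀ r ≤ blockStart (ip.1 + 1) - blockStart ip.1, Measurable[m] fun ω =>
      ∑ j ∈ Finset.range r, ε (blockStart ip.1 + j) ip.2.1 ip.2.2 ω := by
    intro r hr
    refine Finset.measurable_fun_sum _ fun j hj => ?_
    have hj' := Finset.mem_range.1 hj
    have hmem : ((blockStart ip.1 + j, ip.2) : ℕ × K × C) ∈ blockIdx ip :=
      ⟨by simp, by simp only; omega, rfl⟩
    exact (comap_measurable _).mono (le_iSup₂_of_le (f := fun (i : ℕ × K × C)
      (_ : i ∈ blockIdx ip) => MeasurableSpace.comap (ε i.1 i.2.1 i.2.2) inferInstance)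
      _ hmem le_rfl) le_rfl
  unfold excursionEvent
  split_ifs with h
  · refine measurableSet_le (hsum _ ?_) measurable_const
    rw [blockStart_succ]
    exact Nat.sub_le_sub_right (Nat.pow_le_pow_right
      (le_trans one_le_two (two_le_blockStart _)) (by norm_num)) _
  · have : {ω | ∀ r ≤ blockStart (ip.1 + 1) - blockStart ip.1,
        -((blockStart ip.1 : ℝ) / 2 + r / (2 * blockStart ip.1)) ≤
          ∑ j ∈ Finset.range r, ε (blockStart ip.1 + j) ip.2.1 ip.2.2 ω} =
        ⋂ r ∈ Finset.range (blockStart (ip.1 + 1) - blockStart ip.1 + 1),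
          {ω | -((blockStart ip.1 : ℝ) / 2 + r / (2 * blockStart ip.1)) ≤
            ∑ j ∈ Finset.range r, ε (blockStart ip.1 + j) ip.2.1 ip.2.2 ω} := by
      ext ω
      simp
    rw [this]
    exact Finset.measurableSet_biInter _ fun r hr => measurableSet_le measurable_const
      (hsum r (Nat.lt_succ_iff.1 (Finset.mem_range.1 hr)))

/-- The excursion level is `L = l²`, with `l` the start of a good block. Noise before `l` is
negligible by the law of large numbers, noise inside the block is controlled by the events, and
noise after the block by the growth bound `N^(3/4)`. -/
lemma frequently_excursion [Fintype K] [Fintype C] {ε : ℕ → K → C → Ω → ℝ} {a : K × C} {Q : ℕ}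
    {ω : Ω} (hω : ∃ᶠ i in atTop, ∀ p, ω ∈ excursionEvent ε a Q (i, p))
    (hgrow : ∀ p : K × C, ∀ᶠ n : ℕ in atTop,
      noiseSum (fun j k c => ε j k c ω) p n ^ 2 ≤ n * √n) :
    ∃ᶠ L : ℕ in atTop, noiseSum (fun j k c => ε j k c ω) a L ≤ -Q * √L ∧
      ∀ a', a' ≠ a → ∀ N : ℕ, -(√L + N / √L) ≤ noiseSum (fun j k c => ε j k c ω) a' N := by
  set e : ℕ → K → C → ℝ := fun j k c => ε j k c ω with he
  -- With `l ≥ 4 D`, this bounds every walk by `l / 2` up to time `l`, which the margins in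
  -- `excursionEvent` absorb.
  have hbd : ∃ D : ℝ, 0 ≤ D ∧ ∀ p : K × C, ∀ N : ℕ, |noiseSum e p N| ≤ D + N / 4 := by
    have h1 : ∀ p : K × C, ∃ D : ℝ, ∀ N : ℕ, |noiseSum e p N| ≤ D + N / 4 := fun p => by
      obtain ⟨T, hT⟩ := eventually_atTop.1 (((tendsto_noiseSum_div (hgrow p)).abs.eventually_lt_const
        (show |(0 : ℝ)| < 1 / 4 by norm_num)).and (eventually_gt_atTop 0))
      refine ⟨∑ n ∈ Finset.range T, |noiseSum e p n|, fun N => ?_⟩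
      rcases lt_or_ge N T with hN | hN
      · have h2 := Finset.single_le_sum (f := fun n => |noiseSum e p n|)
          (fun _ _ => abs_nonneg _) (Finset.mem_range.2 hN)
        have h3 : (0 : ℝ) ≤ N / 4 := by positivity
        linarith
      · obtain ⟨h2, h3⟩ := hT N hN
        have hNR : (0 : ℝ) < N := by exact_mod_cast h3
        rw [abs_div, abs_of_pos hNR, div_lt_iff₀ hNR] at h2
        have h4 : 0 ≤ ∑ n ∈ Finset.range T, |noiseSum e p n| :=
          Finset.sum_nonneg fun _ _ => abs_nonneg _
        linarith
    choose D hD using h1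
    refine ⟨∑ p, |D p|, Finset.sum_nonneg fun p _ => abs_nonneg _, fun p N => (hD p N).trans ?_⟩
    gcongr
    exact (le_abs_self _).trans
      (Finset.single_le_sum (f := fun p => |D p|) (fun _ _ => abs_nonneg _) (Finset.mem_univ p))
  obtain ⟨D, hD0, hD⟩ := hbd
  obtain ⟨T, hT⟩ := eventually_atTop.1 (eventually_all.2 hgrow)
  have hlt : Tendsto blockStart atTop atTop := blockStart_strictMono.tendsto_atTop
  have hltR : Tendsto (fun i => (blockStart i : ℝ)) atTop atTop :=
    tendsto_natCast_atTop_atTop.comp hlt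
  rw [frequently_atTop]
  intro L₀
  obtain ⟨i, hi, hiL, hiT, hiD⟩ := (hω.and_eventually ((hlt.eventually_ge_atTop L₀).and
    ((hlt.eventually_ge_atTop T).and (hltR.eventually_ge_atTop (4 * D))))).exists
  set l := blockStart i with hl
  have hl2 : 2 ≤ l := two_le_blockStart i
  have hlR : (2 : ℝ) ≤ l := by exact_mod_cast hl2
  have hl0 : (0 : ℝ) < l := by linarith
  have hsq : √((l ^ 2 : ℕ) : ℝ) = l := by
    push_cast
    exact Real.sqrt_sq hl0.le
  have hll : l ≤ l ^ 2 := Nat.le_self_pow two_ne_zero _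
  have hl8 : l ≤ l ^ 8 := Nat.le_self_pow (by norm_num) _
  have hstart : ∀ p (N : ℕ), N ≤ l → |noiseSum e p N| ≤ l / 2 := fun p N hN => by
    have h1 := hD p N
    have h2 : (N : ℝ) ≤ l := by exact_mod_cast hN
    linarith
  refine ⟨l ^ 2, hiL.trans hll, ?_, fun p hp N => ?_⟩
  · rw [hsq]
    have h1 := hi a
    rw [excursionEvent, if_pos rfl, Set.mem_ofPred_eq] at h1
    have h2 := noiseSum_add e a l (l ^ 2 - l)
    rw [Nat.add_sub_cancel' hll] at h2
    rw [h2]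
    have h3 := (abs_le.1 (hstart a l le_rfl)).2
    have h4 : ∑ j ∈ Finset.range (l ^ 2 - l), e (l + j) a.1 a.2 ≤ -(Q + 1) * l := h1
    linarith
  · rw [hsq]
    rcases le_total N l with hN | hN
    · have h1 := (abs_le.1 (hstart p N hN)).1
      have h2 : (0 : ℝ) ≤ N / l := by positivity
      linarith
    · rcases le_total N (l ^ 8) with hN8 | hN8
      · have h1 := hi p
        rw [excursionEvent, if_neg hp, Set.mem_ofPred_eq] at h1
        have h2 : -((l : ℝ) / 2 + (N - l : ℕ) / (2 * l)) ≤
            ∑ j ∈ Finset.range (N - l), e (l + j) p.1 p.2 := by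
          refine h1 (N - l) ?_
          rw [blockStart_succ]
          exact Nat.sub_le_sub_right hN8 _
        have h3 := noiseSum_add e p l (N - l)
        rw [Nat.add_sub_cancel' hN] at h3
        rw [h3]
        have h4 := (abs_le.1 (hstart p l le_rfl)).1
        have h5 : ((N - l : ℕ) : ℝ) / (2 * l) ≤ N / l := by
          rw [Nat.cast_sub hN, div_le_div_iff₀ (by positivity) hl0]
          nlinarith [mul_nonneg hl0.le (Nat.cast_nonneg (α := ℝ) N)]
        linarith
      -- Beyond the block `√N ≥ l²`, hence `N^(3/4) ≤ N / l`.
      · have h1 := hT N (hiT.trans (hl8.trans hN8)) p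
        have hN0 : (0 : ℝ) < N := by
          exact_mod_cast lt_of_lt_of_le (by omega) hN
        have h2 : (l : ℝ) ^ 2 ≤ √N := by
          refine Real.le_sqrt_of_sq_le ?_
          have h3 : (l : ℝ) ^ 8 ≤ N := by exact_mod_cast hN8
          have h4 : ((l : ℝ) ^ 2) ^ 2 ≤ (l : ℝ) ^ 8 := by
            rw [← pow_mul]
            exact pow_le_pow_right₀ (by linarith) (by norm_num)
          linarith
        have h5 : noiseSum e p N ^ 2 ≤ (N / l) ^ 2 := by
          rw [div_pow, le_div_iff₀ (by positivity)]
          have h6 : √(N : ℝ) * √N = N := Real.mul_self_sqrt hN0.le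
          calc noiseSum e p N ^ 2 * (l : ℝ) ^ 2 ≤ (N * √N) * √N := by gcongr
            _ = N ^ 2 := by rw [mul_assoc, h6]; ring
        have h7 := (abs_le.1 (abs_le_of_sq_le_sq h5 (by positivity))).1
        linarith

variable [mΩ : MeasurableSpace Ω] {P : Measure Ω} [IsProbabilityMeasure P]

/-- Both kinds of event are invariant under diffusive scaling (space `l`, time `l²`), which is why
the bound does not depend on the block. -/
lemma exists_pos_le_measure_excursionEvent {v : K → C → ℝ≥0} (hv : ∀ k c, 0 < v k c)
    {ε : ℕ → K → C → Ω → ℝ} (hmeas : ∀ j k c, Measurable (ε j k c))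
    (hlaw : ∀ j k c, P.map (ε j k c) = gaussianReal 0 (v k c))
    (hind : iIndepFun (fun i : ℕ × K × C => ε i.1 i.2.1 i.2.2) P) (a : K × C) (Q : ℕ) (p : K × C) :
    ∃ δ : ENNReal, 0 < δ ∧ ∀ i, δ ≤ P (excursionEvent ε a Q (i, p)) := by
  have hind' : ∀ i, iIndepFun (fun j => ε (blockStart i + j) p.1 p.2) P := fun i =>
    hind.precomp (g := fun j => (blockStart i + j, p)) fun j j' h => by simpa using h
  have hl2 : ∀ i, (2 : ℝ) ≤ blockStart i := fun i => by exact_mod_cast two_le_blockStart i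
  by_cases hp : p = a
  -- The factor `2` compensates `√(l² - l) ≥ l / 2`, valid since `l ≥ 2`.
  · obtain ⟨δ, hδ, h⟩ := exists_pos_le_measure_sum_le (P := P) (hv p.1 p.2) (-(2 * (Q + 1)) : ℝ)
    refine ⟨δ, hδ, fun i => ?_⟩
    rw [excursionEvent, if_pos hp]
    have hl := hl2 i
    have hlt : blockStart i < blockStart i ^ 2 := by
      have := two_le_blockStart i
      nlinarith
    refine h _ (fun j => hmeas _ _ _) (fun j => hlaw _ _ _) (hind' i) _ (Nat.sub_pos_of_lt hlt) _ ?_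
    rw [Nat.cast_sub hlt.le]
    push_cast
    have h1 : (blockStart i : ℝ) / 2 ≤ √((blockStart i : ℝ) ^ 2 - blockStart i) := by
      refine Real.le_sqrt_of_sq_le ?_
      nlinarith
    have hQ : (0 : ℝ) ≤ Q := Nat.cast_nonneg _
    nlinarith
  · have hvR : (0 : ℝ) < v p.1 p.2 := by exact_mod_cast hv p.1 p.2
    -- With `t = -1 / (v l)` in the exponential inequality, crossing the line `-(l / 2 + r / (2 l))`
    -- means exceeding exactly `s`: its slope cancels the compensator `r v t² / 2`.
    set s : ℝ := 1 / (2 * v p.1 p.2) with hs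
    have hs0 : 0 < s := by positivity
    refine ⟨1 - ENNReal.ofReal (Real.exp (-s)), ?_, fun i => ?_⟩
    · rw [tsub_pos_iff_lt, ← ENNReal.ofReal_one]
      exact (ENNReal.ofReal_lt_ofReal_iff one_pos).2 (by simpa using hs0)
    · have hl := hl2 i
      have hl0 : (0 : ℝ) < blockStart i := by linarith
      have hEm : MeasurableSet (excursionEvent ε a Q (i, p)) :=
        iSup₂_le (fun i _ => (hmeas _ _ _).comap_le) _ (measurableSet_excursionEvent ε a Q (i, p))
      have h1 : P (excursionEvent ε a Q (i, p))ᶜ ≤ ENNReal.ofReal (Real.exp (-s)) := by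
        refine (measure_mono ?_).trans (measure_exists_ge_le_exp (fun j => hmeas _ _ _)
          (fun j => hlaw _ _ _) (hind' i) (-(1 / (v p.1 p.2 * blockStart i))) s
          (blockStart (i + 1) - blockStart i))
        intro ω hω
        rw [excursionEvent, if_neg hp, Set.mem_compl_iff, Set.mem_ofPred_eq] at hω
        push Not at hω
        obtain ⟨r, hr, hlt⟩ := hω
        refine ⟨r, hr, ?_⟩
        have h2 : (1 / (v p.1 p.2 * blockStart i)) *
            ∑ j ∈ Finset.range r, ε (blockStart i + j) p.1 p.2 ω ≤
            (1 / (v p.1 p.2 * blockStart i)) *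
              -((blockStart i : ℝ) / 2 + r / (2 * blockStart i)) :=
          mul_le_mul_of_nonneg_left hlt.le (by positivity)
        have h3 : (1 / (v p.1 p.2 * blockStart i)) *
              -((blockStart i : ℝ) / 2 + r / (2 * blockStart i)) =
            -(s + r * (v p.1 p.2 * (-(1 / (v p.1 p.2 * (blockStart i : ℝ)))) ^ 2 / 2)) := by
          rw [hs]
          field_simp
        rw [h3] at h2
        linarith
      rw [tsub_le_iff_right]
      calc (1 : ENNReal) = P (excursionEvent ε a Q (i, p)) + P (excursionEvent ε a Q (i, p))ᶜ := by
            rw [measure_add_measure_compl hEm, measure_univ]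
        _ ≤ _ := by gcongr

/-- Independence across pairs bounds each block's probability below by a fixed positive product;
independence across blocks then permits the second Borel–Cantelli lemma. -/
lemma ae_frequently_excursionEvent [Fintype K] [Fintype C] {v : K → C → ℝ≥0}
    (hv : ∀ k c, 0 < v k c) {ε : ℕ → K → C → Ω → ℝ} (hmeas : ∀ j k c, Measurable (ε j k c))
    (hlaw : ∀ j k c, P.map (ε j k c) = gaussianReal 0 (v k c))
    (hind : iIndepFun (fun i : ℕ × K × C => ε i.1 i.2.1 i.2.2) P) (a : K × C) (Q : ℕ) :
    ∀ᵐ ω ∂P, ∃ᶠ i in atTop, ∀ p, ω ∈ excursionEvent ε a Q (i, p) := by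
  have hV : iIndepSet (excursionEvent ε a Q) P :=
    iIndepSet_of_disjoint_blocks (fun i => (hmeas _ _ _).comap_le) hind.iIndep disjoint_blockIdx
      (measurableSet_excursionEvent ε a Q)
  have hVm : ∀ ip, MeasurableSet (excursionEvent ε a Q ip) := fun ip =>
    iSup₂_le (fun i _ => (hmeas _ _ _).comap_le) _ (measurableSet_excursionEvent ε a Q ip)
  set U : ℕ → Set Ω := fun i => ⋂ p, excursionEvent ε a Q (i, p) with hU
  have hUm : ∀ i, MeasurableSet (U i) := fun i => MeasurableSet.iInter fun p => hVm _
  have hprod : ∀ s : Finset ℕ, P (⋂ i ∈ s, U i) =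
      ∏ i ∈ s, ∏ p, P (excursionEvent ε a Q (i, p)) := by
    intro s
    rw [← Finset.prod_product', ← hV.meas_biInter]
    congr 1
    ext ω
    simp [hU]
    exact ⟨fun h i k c hi => h i hi k c, fun h i hi k c => h i k c hi⟩
  have hUP : ∀ i, P (U i) = ∏ p, P (excursionEvent ε a Q (i, p)) := fun i => by
    simpa using hprod {i}
  have hUind : iIndepSet U P := by
    rw [iIndepSet_iff_meas_biInter hUm]
    intro s
    rw [hprod]
    exact Finset.prod_congr rfl fun i _ => (hUP i).symm
  choose δ hδ hδle using exists_pos_le_measure_excursionEvent hv hmeas hlaw hind a Q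
  have hsum : ∑' i, P (U i) = ⊤ := by
    refine top_le_iff.1 ?_
    calc (⊤ : ENNReal) = ∑' _ : ℕ, ∏ p, δ p :=
          (ENNReal.tsum_const_eq_top_of_ne_zero
            (Finset.prod_ne_zero_iff.2 fun p _ => (hδ p).ne')).symm
      _ ≤ ∑' i, P (U i) := ENNReal.tsum_le_tsum fun i => by
          rw [hUP]
          exact Finset.prod_le_prod' fun p _ => hδle p i
  have h1 := measure_limsup_eq_one hUm hUind hsum
  rw [prob_compl_eq_zero_iff (MeasurableSet.measurableSet_limsup hUm) |>.symm] at h1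
  have h2 : ∀ᵐ ω ∂P, ω ∈ limsup U atTop := h1
  filter_upwards [h2] with ω hω
  rw [mem_limsup_iff_frequently_mem] at hω
  exact hω.mono fun i hi p => Set.mem_iInter.1 hi p

/-- Almost surely the noise grows slowly at every pair, and every pair has arbitrarily deep downward
excursions while the noise at the other pairs stays moderate. -/
lemma ae_regular_noise [Fintype K] [Fintype C] {v : K → C → ℝ≥0}
    (hv : ∀ k c, 0 < v k c) {ε : ℕ → K → C → Ω → ℝ} (hmeas : ∀ j k c, Measurable (ε j k c))
    (hlaw : ∀ j k c, P.map (ε j k c) = gaussianReal 0 (v k c))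
    (hind : iIndepFun (fun i : ℕ × K × C => ε i.1 i.2.1 i.2.2) P) :
    ∀ᵐ ω ∂P,
      (∀ a, Tendsto (fun N : ℕ => noiseSum (fun j k c => ε j k c ω) a N / N) atTop (nhds 0)) ∧
      ∀ a (Q : ℕ), ∃ᶠ L : ℕ in atTop, noiseSum (fun j k c => ε j k c ω) a L ≤ -Q * √L ∧
        ∀ a', a' ≠ a → ∀ N : ℕ,
          -(√L + N / √L) ≤ noiseSum (fun j k c => ε j k c ω) a' N := by
  have hgrow : ∀ᵐ ω ∂P, ∀ p : K × C, ∀ᶠ n : ℕ in atTop,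
      noiseSum (fun j k c => ε j k c ω) p n ^ 2 ≤ n * √n :=
    ae_all_iff.2 fun p => ae_eventually_sum_sq_le (hv p.1 p.2) (fun j => hmeas j p.1 p.2)
      (fun j => hlaw j p.1 p.2)
      (hind.precomp (g := fun j => (j, p)) fun j j' h => by simpa using h)
  have hexc : ∀ᵐ ω ∂P, ∀ (a : K × C) (Q : ℕ), ∃ᶠ i in atTop, ∀ p,
      ω ∈ excursionEvent ε a Q (i, p) :=
    ae_all_iff.2 fun a => ae_all_iff.2 fun Q =>
      ae_frequently_excursionEvent hv hmeas hlaw hind a Q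
  filter_upwards [hgrow, hexc] with ω hgrow hexc
  exact ⟨fun a => tendsto_noiseSum_div (hgrow a), fun a Q => frequently_excursion (hexc a Q) hgrow⟩

end Excursions

end ContextualRS

theorem mainTheorem3 {K C Ω : Type*} [Fintype K] [DecidableEq K] [Nontrivial K]
    [Fintype C] [DecidableEq C] [mΩ : MeasurableSpace Ω] (P : Measure Ω) [IsProbabilityMeasure P]
    (M : ContextualRS.GPModel K C)
    (hcov : ∀ k, (M.cov k).PosDef)
    (hvar : ∀ k c, 0 < M.noiseVar k c)
    (F : K → C → ℝ) (πstar : C → K)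
    (hbest : ∀ c k, k ≠ πstar c → F k c < F (πstar c) c)
    (ε : ℕ → K → C → Ω → ℝ)
    (hε_meas : ∀ j k c, Measurable (ε j k c))
    (hε_law : ∀ j k c, P.map (ε j k c) = gaussianReal 0 (M.noiseVar k c))
    (hε_indep : iIndepFun (fun i : ℕ × K × C => ε i.1 i.2.1 i.2.2) P)
    (𝒰 : MeasurableSpace Ω) (h𝒰 : 𝒰 ≤ mΩ)
    (h𝒰_indep : Indep 𝒰
      (⨆ i : ℕ × K × C, MeasurableSpace.comap (ε i.1 i.2.1 i.2.2) inferInstance) P)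
    (N₀ : ℕ) (X : ℕ → Ω → K × C) (best : ℕ → Ω → C → K)
    (hpolicy : ContextualRS.IsGPCOCBA M F ε 𝒰 N₀ X best) :
    ∀ᵐ ω ∂P, ∀ c, ∀ᶠ B in atTop, best B ω c = πstar c := by
  filter_upwards [ContextualRS.ae_regular_noise (mΩ := mΩ) hvar hε_meas hε_law hε_indep] with ω hω c
  have hpath : ContextualRS.IsRegularPath M F (fun j k c => ε j k c ω) N₀ (fun i => X i ω)
      (fun i => ContextualRS.observation F ε X i ω) (fun n => best n ω) :=
    { posDef := hcov
      noiseVar_pos := hvar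
      observed := fun i => rfl
      predictedBest := fun n => hpolicy.predictedBest n ω
      step := fun n hn => hpolicy.step n ω hn
      lln := hω.1
      excursion := hω.2 }
  exact hpath.eventually_best_eq hbest c
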